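/- Let $(\mathcal X,\mathcal F,\lambda)$ be a measure space, let $N\ge 1$, and let $\pi_0,\dots,\pi_N$ be probability densities with respect to $\lambda$; write $\pi_k[A]=\int_A\pi_k\,d\lambda$. For each $k$ let $T_k$ be a Markov transition kernel on $\mathcal X$ that is reversible with respect to $\pi_k$. Let $\mathcal A=\{A_1,\dots,A_J\}$ be a partition of $\mathcal X$ into measurable sets with $\pi_k[A_j]>0$ for all $k,j$. For a kernel $P$ reversible with respect to a probability measure $\mu$, let $$\mathbf{Gap}(P)=\inf\Big\{\frac{(f,(I-P)f)_\mu}{\mathrm{Var}_\mu(f)}: f\in L_2(\mu),\ \mathrm{Var}_\mu(f)>0\Big\},$$ where $(f,g)_\mu=\int fg\,d\mu$ and $(Pf)(x)=\int f(y)P(x,dy)$; if there is no $f\in L_2(\mu)$ with $\mathrm{Var}_\mu(f)>0$, put $\mathbf{Gap}(P)=1$. For $A$ with $\mu(A)>0$, the restriction $P|_A(x,B)=P(x,B)+\mathbf 1_B(x)P(x,A^c)$ ($x\in A$, $B\subset A$) is a kernel on $A$, reversible with respect to the normalized restriction $\mu(\cdot\cap A)/\mu(A)$. Let $\bar T_0(i,j)=\frac1{\pi_0[A_i]}\int_{A_i}T_0(x,A_j)\,\pi_0(x)\lambda(dx)$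 be the projection matrix of $T_0$ on $\{1,\dots,J\}$, reversible with respect to the distribution $j\mapsto\pi_0[A_j]$. Let $$\delta(\mathcal A)=\min_{|k-l|=1,\ 1\le j\le J}\frac{\int_{A_j}\min\{\pi_k,\pi_l\}\,d\lambda}{\pi_k[A_j]},\qquad \gamma(\mathcal A)=\min_{1\le j\le J}\prod_{k=1}^N\min\Big\{1,\frac{\pi_{k-1}[A_j]}{\pi_k[A_j]}\Big\}.$$ The simulated tempering chain on $\mathcal X\times\{0,\dots,N\}$ has stationary density $\pi_{\rm st}(z,k)=\pi_k(z)/(N+1)$ (with respect to the product of $\lambda$ and counting measure) and transition kernel $P_{\rm st}=Q'T'Q'$. Here $T'$ holds with probability $1/2$ and otherwise moves from $(z,k)$ to $(z',k)$ with $z'\sim T_k(z,\cdot)$; $Q'$ holds with probability $1/2$ and otherwise moves from $(z,k)$ to $(z,l)$ with probability $\pi_l(z)/\sum_{m=0}^N\pi_m(z)$ (at the points $z$ where all the densities vanish, a null set for $\pi_{\rm st}$, it holds). Then $$\mathbf{Gap}(P_{\rm st})\ \ge\ \frac{\gamma(\mathcal A)^{J+3}\,\delta(\mathcal A)^3}{2^{14}(N+1)^5J^3}\;\mathbf{Gap}(\bar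 T_0)\;\min_{0\le k\le N,\ 1\le j\le J}\mathbf{Gap}(T_k|_{A_j}).$$ -/

import Mathlib

open MeasureTheory ProbabilityTheory
open scoped ENNReal NNReal

noncomputable section

namespace Tempering

section General

variable {α : Type*} [MeasurableSpace α]

/-- The Dirichlet form `(f, (I - P) f)_μ`, where `(P f)(x) = ∫ f(y) P(x, dy)`. -/
def dirichletForm (P : Kernel α α) (μ : Measure α) (f : α → ℝ) : ℝ :=
  ∫ x, f x * (f x - ∫ y, f y ∂(P x)) ∂μ

/-- The set of Rayleigh quotients `𝓔(f, f) / Var_μ(f)`, over `f ∈ L₂(μ)` with `Var_μ(f) > 0`. -/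
def rayleighQuotients (P : Kernel α α) (μ : Measure α) : Set ℝ :=
  {r | ∃ f : α → ℝ, MemLp f 2 μ ∧ 0 < variance f μ ∧ r = dirichletForm P μ f / variance f μ}

open Classical in
/-- The spectral gap of a `μ`-reversible kernel `P`: the infimum of the Rayleigh quotients.
If every function in `L₂(μ)` is `μ`-a.e. constant, so that the infimum is over the empty set,
the gap is `1`, the gap of independent sampling from `μ`. -/
def gap (P : Kernel α α) (μ : Measure α) : ℝ :=
  if (rayleighQuotients P μ).Nonempty then sInf (rayleighQuotients P μ) else 1

/-- The kernel that holds with probability `1/2` and otherwise moves according to `P`. -/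
def lazy (P : Kernel α α) : Kernel α α where
  toFun x := (2⁻¹ : ℝ≥0∞) • Measure.dirac x + (2⁻¹ : ℝ≥0∞) • P x
  measurable' := by
    refine Measure.measurable_of_measurable_coe _ fun s hs => ?_
    simp only [Measure.add_apply, Measure.smul_apply, smul_eq_mul]
    exact ((Measure.measurable_coe hs).comp Measure.measurable_dirac).const_mul _ |>.add
      ((P.measurable_coe hs).const_mul _)

/-- The restriction of `P` to `A`, a kernel on `A`:
`P|_A(x, B) = P(x, B) + 1_B(x) P(x, Aᶜ)` for `x ∈ A` and `B ⊆ A`. -/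
def restrictKernel (P : Kernel α α) (A : Set α) (hA : MeasurableSet A) : Kernel A A where
  toFun x := (P x).comap (Subtype.val : A → α) + P x Aᶜ • Measure.dirac x
  measurable' := by
    refine Measure.measurable_of_measurable_coe _ fun s hs => ?_
    simp only [Measure.add_apply, Measure.smul_apply, smul_eq_mul,
      (MeasurableEmbedding.subtype_coe hA).comap_apply]
    refine Measurable.add ?_ (Measurable.mul ?_ ?_)
    · exact (P.measurable_coe (hA.subtype_image hs)).comp measurable_subtype_coe
    · exact (P.measurable_coe hA.compl).comp measurable_subtype_coe
    · exact (Measure.measurable_coe hs).comp Measure.measurable_dirac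

/-- The probability measure `μ|_A` on `A`: `B ↦ μ(B) / μ(A)` for `B ⊆ A`. -/
def restrictMeasure (μ : Measure α) (A : Set α) : Measure A :=
  (μ A)⁻¹ • μ.comap (Subtype.val : A → α)

/-- The entries `P̄(i, j) = μ(A_i)⁻¹ ∫_{A_i} P(x, A_j) μ(dx)` of the projection matrix. -/
def projMatrix {J : ℕ} (P : Kernel α α) (μ : Measure α) (A : Fin J → Set α) (i j : Fin J) :
    ℝ≥0∞ :=
  (μ (A i))⁻¹ * ∫⁻ x in A i, P x (A j) ∂μ

/-- The projection matrix of `P` with respect to `A`, as a kernel on the index set. -/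
def projKernel {J : ℕ} (P : Kernel α α) (μ : Measure α) (A : Fin J → Set α) :
    Kernel (Fin J) (Fin J) :=
  Kernel.ofFunOfCountable fun i => ∑ j, projMatrix P μ A i j • Measure.dirac j

/-- The distribution on the index set giving mass `μ(A_j)` to `j`. -/
def projMeasure {J : ℕ} (μ : Measure α) (A : Fin J → Set α) : Measure (Fin J) :=
  ∑ j, μ (A j) • Measure.dirac j

end General

section Levels

variable {X : Type*} [MeasurableSpace X] {N J : ℕ}

/-- The distribution with density `p` with respect to `lam`. -/
def densityMeasure (lam : Measure X) (p : X → ℝ≥0) : Measure X :=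
  lam.withDensity fun z => (p z : ℝ≥0∞)

/-- The overlap `δ(A)`: the minimum, over levels `k, l` with `|k - l| = 1` and over `j`, of
`∫_{A_j} min{π_k, π_l} dλ / π_k[A_j]`. -/
def overlap (lam : Measure X) (p : Fin (N + 1) → X → ℝ≥0) (A : Fin J → Set X) : ℝ :=
  sInf {r | ∃ (k l : Fin (N + 1)) (j : Fin J), |((k : ℕ) : ℤ) - ((l : ℕ) : ℤ)| = 1 ∧
    r = (∫ z in A j, ((min (p k z) (p l z) : ℝ≥0) : ℝ) ∂lam) /
      (densityMeasure lam (p k)).real (A j)}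

/-- `γ(A) = min_j ∏_{k=1}^N min{1, π_{k-1}[A_j] / π_k[A_j]}`. -/
def gammaA (lam : Measure X) (p : Fin (N + 1) → X → ℝ≥0) (A : Fin J → Set X) : ℝ :=
  ⨅ j : Fin J, ∏ k : Fin N, min 1
    ((densityMeasure lam (p k.castSucc)).real (A j) / (densityMeasure lam (p k.succ)).real (A j))

/-- The stationary distribution of simulated tempering on `X × {0, …, N}`, which has density
`π_st(z, k) = π_k(z) / (N + 1)` with respect to the product of `lam` and counting measure. -/
def stMeasure (lam : Measure X) (p : Fin (N + 1) → X → ℝ≥0) : Measure (X × Fin (N + 1)) :=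
  ∑ k, ((N : ℝ≥0∞) + 1)⁻¹ • (densityMeasure lam (p k)).map fun z => (z, k)

/-- The move that updates `z` according to `T_k`, conditional on `k`. -/
def stateUpdate (T : Fin (N + 1) → Kernel X X) :
    Kernel (X × Fin (N + 1)) (X × Fin (N + 1)) where
  toFun x := (T x.2 x.1).map fun z => (z, x.2)
  measurable' := by
    refine measurable_from_prod_countable_left fun k => ?_
    exact (Measure.measurable_map (fun z : X => (z, k)) measurable_prodMk_right).comp
      (T k).measurable

/-- The move that samples the level from its conditional distribution given `z`, i.e. takes
level `l` with probability `π_l(z) / ∑_m π_m(z)`. At the points `z` where all densities vanish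
(a null set for the stationary distribution) the conditional distribution is undefined, and
the move holds. -/
def levelUpdate (p : Fin (N + 1) → X → ℝ≥0) (hp : ∀ k, Measurable (p k)) :
    Kernel (X × Fin (N + 1)) (X × Fin (N + 1)) where
  toFun x :=
    if ∑ m, p m x.1 = 0 then Measure.dirac x
    else ∑ l, ((p l x.1 / ∑ m, p m x.1 : ℝ≥0) : ℝ≥0∞) • Measure.dirac (x.1, l)
  measurable' := by
    have hs : Measurable fun x : X × Fin (N + 1) => ∑ m, p m x.1 :=
      Finset.measurable_sum _ fun m _ => (hp m).comp measurable_fst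
    refine Measurable.ite (hs (measurableSet_singleton 0)) Measure.measurable_dirac ?_
    refine Measure.measurable_of_measurable_coe _ fun s hms => ?_
    simp only [Measure.finsetSum_apply, Measure.smul_apply, smul_eq_mul]
    refine Finset.measurable_sum _ fun l _ => Measurable.mul ?_ ?_
    · exact (((hp l).comp measurable_fst).div hs).coe_nnreal_ennreal
    · exact (Measure.measurable_coe hms).comp
        (Measure.measurable_dirac.comp (measurable_fst.prodMk measurable_const))

/-- The simulated tempering kernel `P_st = Q' T' Q'`, both moves having a holding probability
of `1/2`. -/
def stKernel (p : Fin (N + 1) → X → ℝ≥0) (hp : ∀ k, Measurable (p k))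
    (T : Fin (N + 1) → Kernel X X) : Kernel (X × Fin (N + 1)) (X × Fin (N + 1)) :=
  lazy (levelUpdate p hp) ∘ₖ lazy (stateUpdate T) ∘ₖ lazy (levelUpdate p hp)

end Levels

end Tempering

end

/-! It suffices to prove a Poincaré inequality with the larger constant γδ/(104(N+1)²) · Gap(T̄₀) ·
g, where g is the least gap of the restricted kernels; since γ, δ ≤ 1 and N + 1, J ≥ 1, this
constant dominates the stated one.

Let a(k,j) be the average of f(·,k) over A_j under π_k, and let c be the π₀-mean of f(·,0). Up to
the factor N+1, Var(f) is at most W + B, where W collects the variances inside the cells and B = ∑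
π_k[A_j](a(k,j) − c)². The restricted gaps give gW ≤ S, where S is the sum of the Dirichlet forms of
the T_k (`mul_sum_setIntegral_le`).

For B, each cell is followed down the levels to level 0 (`mul_sum_sq_sub_le`): γ allows the weight
of level k to be replaced by that of any lower level, and Cauchy–Schwarz along the path leaves the
deviations B₀ at level 0 and the increments D between adjacent levels. B₀ is controlled by Gap(T̄₀),
applied to the function with value a(0,j) on A_j (`gap_projKernel_mul_sum_le`). For D, two adjacent
averages are compared on the overlap of their densities through the conditional mean m(z) of f given
the state, which is common to all levels (`overlap_mul_sq_sub_le`); the price is W and R, the sum of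
the squared distances of f(·,k) from m.

Finally R and S are both dominated by the Dirichlet form of Q'T'Q' (`le_dirichletForm_sandwich`),
because Q is an orthogonal projection, namely conditional expectation given z. `combine_estimates`
assembles these bounds. -/

namespace Tempering

/-! ### Dirichlet forms, spectral gaps and lazy kernels -/

section General

set_option linter.unusedSectionVars false

variable {α : Type*} [MeasurableSpace α] {P : Kernel α α} [IsMarkovKernel P]
  {μ : Measure α} [IsProbabilityMeasure μ]

lemma measurePreserving_fst_compProd : MeasurePreserving Prod.fst (μ ⊗ₘ P) μ :=
  ⟨measurable_fst, Measure.fst_compProd μ P⟩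

lemma measurePreserving_snd_compProd (hP : P.Invariant μ) :
    MeasurePreserving Prod.snd (μ ⊗ₘ P) μ :=
  ⟨measurable_snd, (Measure.snd_compProd μ P).trans hP⟩

lemma integrable_mul_compProd (hP : P.Invariant μ) {f h : α → ℝ} (hf : MemLp f 2 μ)
    (hh : MemLp h 2 μ) : Integrable (fun w : α × α => f w.1 * h w.2) (μ ⊗ₘ P) :=
  (hf.comp_measurePreserving measurePreserving_fst_compProd).integrable_mul
    (hh.comp_measurePreserving (measurePreserving_snd_compProd hP))

lemma integral_mul_integral_eq (hP : P.Invariant μ) {f h : α → ℝ} (hf : MemLp f 2 μ)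
    (hh : MemLp h 2 μ) :
    ∫ x, f x * ∫ y, h y ∂(P x) ∂μ = ∫ w, f w.1 * h w.2 ∂(μ ⊗ₘ P) := by
  rw [Measure.integral_compProd (integrable_mul_compProd hP hf hh)]
  simp_rw [integral_const_mul]

lemma ae_integrable_kernel (hP : P.Invariant μ) {f : α → ℝ} (hf : Integrable f μ) :
    ∀ᵐ x ∂μ, Integrable f (P x) := by
  rw [← hP.def] at hf
  exact Measure.ae_integrable_of_integrable_comp hf

lemma integrable_integral_kernel (hP : P.Invariant μ) {f : α → ℝ} (hf : Integrable f μ) :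
    Integrable (fun x => ∫ y, f y ∂(P x)) μ := by
  rw [← hP.def, Measure.comp_eq_comp_const_apply] at hf
  exact hf.integral_comp

/-- The averaging operator of an invariant kernel maps `L₂` to `L₂`. -/
lemma memLp_integral_kernel (hP : P.Invariant μ) {f : α → ℝ} (hf : MemLp f 2 μ) :
    MemLp (fun x => ∫ y, f y ∂(P x)) 2 μ := by
  have hf1 : Integrable f μ := hf.integrable (by norm_num)
  have hm := (integrable_integral_kernel hP hf1).aestronglyMeasurable
  rw [memLp_two_iff_integrable_sq hm]
  refine (integrable_integral_kernel hP hf.integrable_sq).mono' (hm.pow 2) ?_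
  filter_upwards [ae_integrable_kernel hP hf1, ae_integrable_kernel hP hf.integrable_sq]
    with x hx hx2
  have hL : MemLp f 2 (P x) := (memLp_two_iff_integrable_sq hx.aestronglyMeasurable).2 hx2
  -- Jensen's inequality (Pf)² ≤ P(f²), read off from the nonnegativity of the variance of f under P
  -- x.
  have h0 := variance_nonneg f (P x)
  rw [variance_eq_sub hL] at h0
  simp only [Pi.pow_apply] at h0
  rw [Real.norm_of_nonneg (sq_nonneg _)]
  linarith

lemma memLp_diff_compProd (hP : P.Invariant μ) {f : α → ℝ} (hf : MemLp f 2 μ) :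
    MemLp (fun w : α × α => f w.1 - f w.2) 2 (μ ⊗ₘ P) :=
  (hf.comp_measurePreserving measurePreserving_fst_compProd).sub
    (hf.comp_measurePreserving (measurePreserving_snd_compProd hP))

lemma integral_fst_compProd {f : α → ℝ} (hf : AEStronglyMeasurable f μ) :
    ∫ w, f w.1 ∂(μ ⊗ₘ P) = ∫ x, f x ∂μ := by
  have h := measurePreserving_fst_compProd (P := P) (μ := μ)
  conv_rhs => rw [← h.map_eq]
  rw [integral_map h.measurable.aemeasurable (by rwa [h.map_eq])]

lemma integral_snd_compProd (hP : P.Invariant μ) {f : α → ℝ} (hf : AEStronglyMeasurable f μ) :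
    ∫ w, f w.2 ∂(μ ⊗ₘ P) = ∫ x, f x ∂μ := by
  have h := measurePreserving_snd_compProd hP
  conv_rhs => rw [← h.map_eq]
  rw [integral_map h.measurable.aemeasurable (by rwa [h.map_eq])]

lemma dirichletForm_eq_sub (hP : P.Invariant μ) {f : α → ℝ} (hf : MemLp f 2 μ) :
    dirichletForm P μ f = ∫ x, f x ^ 2 ∂μ - ∫ x, f x * ∫ y, f y ∂(P x) ∂μ := by
  have h : Integrable (fun x => f x * ∫ y, f y ∂(P x)) μ :=
    hf.integrable_mul (memLp_integral_kernel hP hf)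
  rw [← integral_sub hf.integrable_sq h]
  unfold dirichletForm
  congr 1; ext x; ring

/-- The symmetric expression of the Dirichlet form. -/
lemma dirichletForm_eq (hP : P.Invariant μ) {f : α → ℝ} (hf : MemLp f 2 μ) :
    dirichletForm P μ f = (∫ w, (f w.1 - f w.2) ^ 2 ∂(μ ⊗ₘ P)) / 2 := by
  have h1 := integral_fst_compProd (P := P) hf.integrable_sq.aestronglyMeasurable
  have h2 := integral_snd_compProd hP hf.integrable_sq.aestronglyMeasurable
  have i1 : Integrable (fun w : α × α => f w.1 ^ 2) (μ ⊗ₘ P) :=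
    (hf.comp_measurePreserving measurePreserving_fst_compProd).integrable_sq
  have i2 : Integrable (fun w : α × α => f w.2 ^ 2) (μ ⊗ₘ P) :=
    (hf.comp_measurePreserving (measurePreserving_snd_compProd hP)).integrable_sq
  have i3 := integrable_mul_compProd hP hf hf
  have h3 : ∫ w, (f w.1 - f w.2) ^ 2 ∂(μ ⊗ₘ P) =
      ∫ w, f w.1 ^ 2 ∂(μ ⊗ₘ P) + ∫ w, f w.2 ^ 2 ∂(μ ⊗ₘ P)
        - 2 * ∫ w, f w.1 * f w.2 ∂(μ ⊗ₘ P) := by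
    rw [← integral_const_mul, ← integral_add i1 i2, ← integral_sub _ (i3.const_mul 2)]
    · congr 1; ext w; ring
    · exact i1.add i2
  rw [dirichletForm_eq_sub hP hf, integral_mul_integral_eq hP hf hf, h3, h1, h2]; ring

lemma dirichletForm_nonneg (hP : P.Invariant μ) {f : α → ℝ} (hf : MemLp f 2 μ) :
    0 ≤ dirichletForm P μ f := by
  rw [dirichletForm_eq hP hf]
  exact div_nonneg (integral_nonneg fun _ => sq_nonneg _) zero_le_two

lemma dirichletForm_add_le (hP : P.Invariant μ) {f h : α → ℝ} (hf : MemLp f 2 μ)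
    (hh : MemLp h 2 μ) :
    dirichletForm P μ (f + h) ≤ 2 * dirichletForm P μ f + 2 * dirichletForm P μ h := by
  rw [dirichletForm_eq hP hf, dirichletForm_eq hP hh, dirichletForm_eq hP (hf.add hh)]
  have i1 := (memLp_diff_compProd hP hf).integrable_sq
  have i2 := (memLp_diff_compProd hP hh).integrable_sq
  have : ∫ w, ((f + h) w.1 - (f + h) w.2) ^ 2 ∂(μ ⊗ₘ P) ≤
      ∫ w, (2 * (f w.1 - f w.2) ^ 2 + 2 * (h w.1 - h w.2) ^ 2) ∂(μ ⊗ₘ P) := by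
    refine integral_mono (memLp_diff_compProd hP (hf.add hh)).integrable_sq
      ((i1.const_mul 2).add (i2.const_mul 2)) fun w => ?_
    simp only [Pi.add_apply]
    nlinarith [sq_nonneg ((f w.1 - f w.2) - (h w.1 - h w.2))]
  rw [integral_add (i1.const_mul 2) (i2.const_mul 2), integral_const_mul,
    integral_const_mul] at this
  linarith

/-- (s − t)² ≤ 2s² + 2t², and both marginals of `μ ⊗ₘ P` are `μ`. -/
lemma dirichletForm_le_two_mul (hP : P.Invariant μ) {f : α → ℝ} (hf : MemLp f 2 μ) :
    dirichletForm P μ f ≤ 2 * ∫ x, f x ^ 2 ∂μ := by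
  have h1 := integral_fst_compProd (P := P) hf.integrable_sq.aestronglyMeasurable
  have h2 := integral_snd_compProd hP hf.integrable_sq.aestronglyMeasurable
  have i1 : Integrable (fun w : α × α => f w.1 ^ 2) (μ ⊗ₘ P) :=
    (hf.comp_measurePreserving measurePreserving_fst_compProd).integrable_sq
  have i2 : Integrable (fun w : α × α => f w.2 ^ 2) (μ ⊗ₘ P) :=
    (hf.comp_measurePreserving (measurePreserving_snd_compProd hP)).integrable_sq
  have : ∫ w, (f w.1 - f w.2) ^ 2 ∂(μ ⊗ₘ P) ≤
      ∫ w, (2 * f w.1 ^ 2 + 2 * f w.2 ^ 2) ∂(μ ⊗ₘ P) := by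
    refine integral_mono (memLp_diff_compProd hP hf).integrable_sq
      ((i1.const_mul 2).add (i2.const_mul 2)) fun w => ?_
    nlinarith [sq_nonneg (f w.1 + f w.2)]
  rw [integral_add (i1.const_mul 2) (i2.const_mul 2), integral_const_mul,
    integral_const_mul, h1, h2] at this
  rw [dirichletForm_eq hP hf]
  linarith

/-- The Dirichlet form does not see constants, so f may be centred in the preceding bound. -/
lemma dirichletForm_le_two_mul_variance (hP : P.Invariant μ) {f : α → ℝ} (hf : MemLp f 2 μ) :
    dirichletForm P μ f ≤ 2 * variance f μ := by
  have hg : MemLp (fun x => f x - ∫ y, f y ∂μ) 2 μ := hf.sub (memLp_const _)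
  have h := dirichletForm_le_two_mul hP hg
  rw [dirichletForm_eq hP hg] at h
  rw [dirichletForm_eq hP hf, variance_eq_integral hf.aestronglyMeasurable.aemeasurable]
  simpa using h

/-- The Dirichlet form of a measurable function as a lower Lebesgue integral. -/
lemma ofReal_two_mul_dirichletForm (hP : P.Invariant μ) {f : α → ℝ} (hfm : Measurable f)
    (hf : MemLp f 2 μ) :
    ENNReal.ofReal (2 * dirichletForm P μ f) =
      ∫⁻ x, ∫⁻ y, ENNReal.ofReal ((f x - f y) ^ 2) ∂(P x) ∂μ := by
  rw [dirichletForm_eq hP hf, mul_div_cancel₀ _ two_ne_zero,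
    ofReal_integral_eq_lintegral_ofReal (memLp_diff_compProd hP hf).integrable_sq
      (ae_of_all _ fun _ => sq_nonneg _), Measure.lintegral_compProd]
  fun_prop

/-- By invariance a `μ`-null set is null for `P x` at almost every x, so `P f` is unchanged almost
everywhere too. -/
lemma dirichletForm_congr (hP : P.Invariant μ) {f h : α → ℝ} (hfh : f =ᵐ[μ] h) :
    dirichletForm P μ f = dirichletForm P μ h := by
  have h2 : ∀ᵐ x ∂μ, f =ᵐ[P x] h := by
    refine Measure.ae_ae_of_ae_comp ?_
    rw [hP.def]; exact hfh
  refine integral_congr_ae ?_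
  filter_upwards [hfh, h2] with x hx hx2
  rw [hx, integral_congr_ae hx2]

/-- Reversibility says that `μ ⊗ₘ P` is invariant under swapping coordinates; this makes the
averaging operator self-adjoint. -/
lemma integral_mul_integral_comm (hP : P.IsReversible μ) {f h : α → ℝ} (hf : MemLp f 2 μ)
    (hh : MemLp h 2 μ) :
    ∫ x, f x * ∫ y, h y ∂(P x) ∂μ = ∫ x, (∫ y, f y ∂(P x)) * h x ∂μ := by
  have hswap : (μ ⊗ₘ P).map Prod.swap = μ ⊗ₘ P := by
    refine Measure.ext_prod fun {s t} hs ht => ?_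
    rw [Measure.map_apply measurable_swap (hs.prod ht), Set.preimage_swap_prod,
      Measure.compProd_apply_prod ht hs, Measure.compProd_apply_prod hs ht]
    exact hP ht hs
  simp_rw [mul_comm _ (h _)]
  rw [integral_mul_integral_eq hP.invariant hf hh, integral_mul_integral_eq hP.invariant hh hf]
  conv_rhs => rw [← hswap]
  rw [integral_map measurable_swap.aemeasurable]
  · simp [mul_comm]
  · rw [hswap]; exact (integrable_mul_compProd hP.invariant hh hf).aestronglyMeasurable

lemma rayleighQuotients_bddBelow (hP : P.Invariant μ) : BddBelow (rayleighQuotients P μ) := by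
  refine ⟨0, ?_⟩
  rintro r ⟨f, hf, hv, rfl⟩
  exact div_nonneg (dirichletForm_nonneg hP hf) hv.le

/-- The Poincaré inequality with the spectral gap as its constant. -/
lemma gap_mul_variance_le (hP : P.Invariant μ) {f : α → ℝ} (hf : MemLp f 2 μ) :
    gap P μ * variance f μ ≤ dirichletForm P μ f := by
  rcases (variance_nonneg f μ).eq_or_lt with h | h
  · rw [← h, mul_zero]; exact dirichletForm_nonneg hP hf
  · have hmem : dirichletForm P μ f / variance f μ ∈ rayleighQuotients P μ := ⟨f, hf, h, rfl⟩
    rw [gap, if_pos ⟨_, hmem⟩, ← le_div_iff₀ h]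
    exact csInf_le (rayleighQuotients_bddBelow hP) hmem

lemma gap_nonneg (hP : P.Invariant μ) : 0 ≤ gap P μ := by
  unfold gap
  split_ifs with h
  · refine le_csInf h ?_
    rintro r ⟨f, hf, hv, rfl⟩
    exact div_nonneg (dirichletForm_nonneg hP hf) hv.le
  · exact zero_le_one

lemma gap_le_two (hP : P.Invariant μ) : gap P μ ≤ 2 := by
  unfold gap
  split_ifs with h
  · obtain ⟨r, f, hf, hv, rfl⟩ := h
    refine (csInf_le (rayleighQuotients_bddBelow hP) ⟨f, hf, hv, rfl⟩).trans ?_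
    rw [div_le_iff₀ hv]
    exact dirichletForm_le_two_mul_variance hP hf
  · norm_num

/-- A Poincaré inequality with constant `c ≤ 1` for measurable functions bounds the gap. -/
lemma le_gap (hP : P.Invariant μ) {c : ℝ} (hc : c ≤ 1)
    (h : ∀ f : α → ℝ, Measurable f → MemLp f 2 μ → c * variance f μ ≤ dirichletForm P μ f) :
    c ≤ gap P μ := by
  unfold gap
  split_ifs with hne
  · refine le_csInf hne ?_
    rintro r ⟨f, hf, hv, rfl⟩
    -- Passing to a strongly measurable version is why it is enough to test measurable functions.
    obtain ⟨f', hf', hff'⟩ := hf.aestronglyMeasurable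
    rw [le_div_iff₀ hv, dirichletForm_congr hP hff', variance_congr hff']
    exact h f' hf'.measurable (hf.ae_eq hff')
  -- With no nonconstant function the gap is 1 by convention; only here is c ≤ 1 needed.
  · exact hc

instance isMarkovKernel_lazy : IsMarkovKernel (lazy P) :=
  ⟨fun x => ⟨by
    change ((2⁻¹ : ℝ≥0∞) • Measure.dirac x + (2⁻¹ : ℝ≥0∞) • P x) Set.univ = 1
    simp [ENNReal.inv_two_add_inv_two]⟩⟩

lemma integral_lazy {f : α → ℝ} {x : α} (hfm : Measurable f) (hf : Integrable f (P x)) :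
    ∫ y, f y ∂(lazy P x) = (f x + ∫ y, f y ∂(P x)) / 2 := by
  change ∫ y, f y ∂((2⁻¹ : ℝ≥0∞) • Measure.dirac x + (2⁻¹ : ℝ≥0∞) • P x) = _
  have hd : Integrable f (Measure.dirac x) :=
    integrable_dirac' hfm.stronglyMeasurable (by simp)
  rw [integral_add_measure (hd.smul_measure (by simp)) (hf.smul_measure (by simp)),
    integral_smul_measure, integral_smul_measure, integral_dirac' _ _ hfm.stronglyMeasurable]
  simp
  ring

lemma isReversible_lazy (hP : P.IsReversible μ) : (lazy P).IsReversible μ := by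
  intro A B hA hB
  have key : ∀ A B : Set α, MeasurableSet A → MeasurableSet B → ∫⁻ x in A, lazy P x B ∂μ =
      2⁻¹ * μ (A ∩ B) + 2⁻¹ * ∫⁻ x in A, P x B ∂μ := by
    intro A B hA hB
    change ∫⁻ x in A, ((2⁻¹ : ℝ≥0∞) • Measure.dirac x + (2⁻¹ : ℝ≥0∞) • P x) B ∂μ = _
    simp only [Measure.add_apply, Measure.smul_apply, smul_eq_mul, Measure.dirac_apply' _ hB]
    rw [lintegral_add_right _ ((P.measurable_coe hB).const_mul _),
      lintegral_const_mul _ (measurable_one.indicator hB),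
      lintegral_const_mul _ (P.measurable_coe hB), lintegral_indicator_one hB,
      Measure.restrict_apply hB, Set.inter_comm]
  rw [key A B hA hB, key B A hB hA, hP hA hB, Set.inter_comm]

lemma dirichletForm_lazy (hP : P.Invariant μ) {f : α → ℝ} (hfm : Measurable f)
    (hf : MemLp f 2 μ) : dirichletForm (lazy P) μ f = dirichletForm P μ f / 2 := by
  unfold dirichletForm
  rw [← integral_div]
  refine integral_congr_ae ?_
  filter_upwards [ae_integrable_kernel hP (hf.integrable (by norm_num))] with x hx
  rw [integral_lazy hfm hx]; ring

end General

/-! ### The Dirichlet form of Q'T'Q' -/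

section Sandwich

variable {α : Type*} [MeasurableSpace α] {Q T : Kernel α α} [IsMarkovKernel Q] [IsMarkovKernel T]
  {μ : Measure α} [IsProbabilityMeasure μ]

/-- The averaging operator of a composition of kernels preserving `μ`. -/
lemma ae_integral_comp (hQ : Q.Invariant μ) (hT : T.Invariant μ) {f : α → ℝ}
    (hf : Integrable f μ) :
    ∀ᵐ x ∂μ, ∫ y, f y ∂((Q ∘ₖ T) x) = ∫ y, ∫ z, f z ∂(Q y) ∂(T x) := by
  filter_upwards [ae_integrable_kernel (hQ.comp hT) hf] with x hx
  exact Kernel.integral_comp hx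

/-- The Dirichlet form of `Q' T' Q'`, where `Q'` and `T'` are the lazy versions of an orthogonal
projection `Q` and of a kernel `T`. -/
lemma le_dirichletForm_sandwich (hQ : Q.IsReversible μ) (hT : T.Invariant μ)
    (hTl : (lazy T).Invariant μ) {f : α → ℝ}
    (hQQ : ∀ x, ∫ y, ∫ z, f z ∂(Q y) ∂(Q x) = ∫ z, f z ∂(Q x))
    (hfm : Measurable f) (hf : MemLp f 2 μ) :
    (∫ x, (f x - ∫ y, f y ∂(Q x)) ^ 2 ∂μ) / 2 + dirichletForm T μ f / 4 ≤
      dirichletForm (lazy Q ∘ₖ lazy T ∘ₖ lazy Q) μ f := by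
  have hQl := isReversible_lazy hQ
  have hQi := hQl.invariant
  have hf1 : Integrable f μ := hf.integrable (by norm_num)
  set u : α → ℝ := fun x => ∫ y, f y ∂(Q x) with hu
  set φ : α → ℝ := fun x => ∫ y, f y ∂(lazy Q x) with hφ
  have hum : MemLp u 2 μ := memLp_integral_kernel hQ.invariant hf
  have hφL : MemLp φ 2 μ := memLp_integral_kernel hQi hf
  have hφm : Measurable φ := (hfm.stronglyMeasurable.integral_kernel).measurable
  have hφu : φ =ᵐ[μ] fun x => (f x + u x) / 2 := by
    filter_upwards [ae_integrable_kernel hQ.invariant hf1] with x hx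
    exact integral_lazy hfm hx
  -- the orthogonality of `f - Q f` and `Q f`
  have horth : ∫ x, f x * u x ∂μ = ∫ x, u x ^ 2 ∂μ := by
    have h := integral_mul_integral_comm hQ hf hum
    have h' : ∀ x, ∫ y, u y ∂(Q x) = u x := hQQ
    simp only [h'] at h
    rw [h]
    simp only [sq, hu]
  have iff2 := hf.integrable_sq
  have iuu := hum.integrable_sq
  have ifu : Integrable (fun x => f x * u x) μ := hf.integrable_mul hum
  have hg : ∫ x, (f x - u x) ^ 2 ∂μ = ∫ x, f x ^ 2 ∂μ - ∫ x, u x ^ 2 ∂μ := by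
    have : ∫ x, (f x - u x) ^ 2 ∂μ
        = ∫ x, f x ^ 2 ∂μ - 2 * ∫ x, f x * u x ∂μ + ∫ x, u x ^ 2 ∂μ := by
      rw [← integral_const_mul, ← integral_sub iff2 (ifu.const_mul 2), ← integral_add _ iuu]
      · congr 1; ext x; ring
      · exact iff2.sub (ifu.const_mul 2)
    rw [this, horth]; ring
  -- Here φ = Q'f = (f + u)/2 with u = Qf. The cross term equals ‖u‖², so ‖f‖² − ‖φ‖² = ¾‖f − u‖².
  have hφsq : ∫ x, φ x ^ 2 ∂μ = (∫ x, f x ^ 2 ∂μ) / 4 + 3 / 4 * ∫ x, u x ^ 2 ∂μ := by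
    have : ∫ x, φ x ^ 2 ∂μ
        = 1 / 4 * ∫ x, f x ^ 2 ∂μ + 1 / 2 * ∫ x, f x * u x ∂μ + 1 / 4 * ∫ x, u x ^ 2 ∂μ := by
      rw [← integral_const_mul, ← integral_const_mul, ← integral_const_mul,
        ← integral_add (iff2.const_mul _) (ifu.const_mul _), ← integral_add _ (iuu.const_mul _)]
      · refine integral_congr_ae ?_
        filter_upwards [hφu] with x hx
        rw [hx]; ring
      · exact (iff2.const_mul _).add (ifu.const_mul _)
    rw [this, horth]; ring
  -- Self-adjointness of Q' gives (f, Q'T'Q'f) = (φ, T'φ), and laziness halves the form of T.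
  have hmain : dirichletForm (lazy Q ∘ₖ lazy T ∘ₖ lazy Q) μ f =
      ∫ x, f x ^ 2 ∂μ - ∫ x, φ x ^ 2 ∂μ + dirichletForm T μ φ / 2 := by
    have hinv := (hQi.comp hTl).comp hQi
    rw [dirichletForm_eq_sub hinv hf, ← dirichletForm_lazy hT hφm hφL,
      dirichletForm_eq_sub hTl hφL]
    have h1 : ∫ x, f x * ∫ y, f y ∂((lazy Q ∘ₖ lazy T ∘ₖ lazy Q) x) ∂μ =
        ∫ x, f x * ∫ y, ∫ z, φ z ∂(lazy T y) ∂(lazy Q x) ∂μ := by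
      refine integral_congr_ae ?_
      have hcomp : ∀ᵐ x ∂μ, ∀ᵐ y ∂(lazy Q x),
          ∫ z, f z ∂((lazy Q ∘ₖ lazy T) y) = ∫ z, φ z ∂(lazy T y) := by
        refine Measure.ae_ae_of_ae_comp ?_
        rw [hQi.def]
        exact ae_integral_comp hQi hTl hf1
      filter_upwards [hcomp, ae_integral_comp (hQi.comp hTl) hQi hf1] with x hx hx2
      rw [hx2, integral_congr_ae hx]
    rw [h1, integral_mul_integral_comm hQl hf (memLp_integral_kernel hTl hφL)]
    ring
  -- Write f = φ + (f − u)/2; the remainder costs 2 · 2 · ¼‖f − u‖².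
  have hfφ : dirichletForm T μ f ≤ 2 * dirichletForm T μ φ + ∫ x, (f x - u x) ^ 2 ∂μ := by
    have hd : MemLp (fun x => (1 / 2 : ℝ) * (f x - u x)) 2 μ := (hf.sub hum).const_mul _
    have heq : f =ᵐ[μ] φ + fun x => (1 / 2 : ℝ) * (f x - u x) := by
      filter_upwards [hφu] with x hx
      simp only [Pi.add_apply, hx]; ring
    rw [dirichletForm_congr hT heq]
    refine (dirichletForm_add_le hT hφL hd).trans ?_
    have h := dirichletForm_le_two_mul hT hd
    have h2 : ∫ x, ((1 / 2 : ℝ) * (f x - u x)) ^ 2 ∂μ = 1 / 4 * ∫ x, (f x - u x) ^ 2 ∂μ := by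
      rw [← integral_const_mul]; congr 1; ext x; ring
    rw [h2] at h
    linarith
  change (∫ x, (f x - u x) ^ 2 ∂μ) / 2 + _ ≤ _
  rw [hmain, hφsq]
  -- Half the form of φ is at least a quarter of the form of f minus ¼‖f − u‖²; the remaining
  -- coefficient is ¾ − ¼ = ½.
  linarith

end Sandwich

/-! ### Restriction of a kernel to one cell -/

section Restrict

set_option linter.unusedSectionVars false

variable {α : Type*} [MeasurableSpace α] {P : Kernel α α} [IsMarkovKernel P]
  {μ : Measure α} [IsProbabilityMeasure μ] {A : Set α}

lemma restrictKernel_apply (hA : MeasurableSet A) (x : A) :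
    restrictKernel P A hA x = (P x).comap (Subtype.val : A → α) + P x Aᶜ • Measure.dirac x := rfl

instance isMarkovKernel_restrictKernel (hA : MeasurableSet A) :
    IsMarkovKernel (restrictKernel P A hA) := by
  refine ⟨fun x => ⟨?_⟩⟩
  rw [restrictKernel_apply, Measure.add_apply,
    (MeasurableEmbedding.subtype_coe hA).comap_apply]
  simp [prob_add_prob_compl hA]

lemma isProbabilityMeasure_restrictMeasure (hA : MeasurableSet A) (h0 : μ A ≠ 0) :
    IsProbabilityMeasure (restrictMeasure μ A) := by
  refine ⟨?_⟩
  rw [restrictMeasure, Measure.smul_apply, (MeasurableEmbedding.subtype_coe hA).comap_apply]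
  simp [ENNReal.inv_mul_cancel h0 (measure_ne_top μ A)]

lemma lintegral_restrictMeasure (hA : MeasurableSet A) (F : α → ℝ≥0∞) :
    ∫⁻ x, F x ∂(restrictMeasure μ A) = (μ A)⁻¹ * ∫⁻ x in A, F x ∂μ := by
  rw [restrictMeasure, lintegral_smul_measure, lintegral_subtype_comap hA, smul_eq_mul]

lemma integral_restrictMeasure (hA : MeasurableSet A) (F : α → ℝ) :
    ∫ x, F x ∂(restrictMeasure μ A) = ⨍ x in A, F x ∂μ := by
  rw [restrictMeasure, integral_smul_measure, integral_subtype_comap hA, setAverage_eq,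
    ENNReal.toReal_inv]
  rfl

/-- The holding part charges only B ∩ C, so it is symmetric in B and C; the rest is reversibility of
`P`. -/
lemma isReversible_restrictKernel (hP : P.IsReversible μ) (hA : MeasurableSet A) :
    (restrictKernel P A hA).IsReversible (restrictMeasure μ A) := by
  have key : ∀ B C : Set A, MeasurableSet B → MeasurableSet C →
      ∫⁻ x in B, restrictKernel P A hA x C ∂(restrictMeasure μ A) =
        (μ A)⁻¹ * (∫⁻ x in Subtype.val '' B, P x (Subtype.val '' C) ∂μ +
          ∫⁻ x in Subtype.val '' (B ∩ C), P x Aᶜ ∂μ) := by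
    intro B C hB hC
    have hB' := hA.subtype_image hB
    have hC' := hA.subtype_image hC
    have hBC' := hA.subtype_image (hB.inter hC)
    rw [← lintegral_indicator hB]
    have : ∀ x : A, B.indicator (fun x => restrictKernel P A hA x C) x =
        (Subtype.val '' B).indicator (fun x => P x (Subtype.val '' C)) (x : α) +
        (Subtype.val '' (B ∩ C)).indicator (fun x => P x Aᶜ) (x : α) := by
      intro x
      simp only [Set.indicator, Subtype.val_injective.mem_set_image, restrictKernel_apply,
        Measure.add_apply, (MeasurableEmbedding.subtype_coe hA).comap_apply,
        Measure.smul_apply, smul_eq_mul, Measure.dirac_apply' _ hC, Set.mem_inter_iff]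
      by_cases h1 : x ∈ B <;> by_cases h2 : x ∈ C <;> simp [h1, h2]
    simp_rw [this]
    rw [lintegral_restrictMeasure hA (fun x =>
        (Subtype.val '' B).indicator (fun x => P x (Subtype.val '' C)) x +
        (Subtype.val '' (B ∩ C)).indicator (fun x => P x Aᶜ) x),
      lintegral_add_left ((P.measurable_coe hC').indicator hB'),
      lintegral_indicator hB', lintegral_indicator hBC', Measure.restrict_restrict hB',
      Measure.restrict_restrict hBC', Set.inter_eq_left.2 (Subtype.coe_image_subset A B),
      Set.inter_eq_left.2 (Subtype.coe_image_subset A (B ∩ C))]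
  intro B C hB hC
  rw [key B C hB hC, key C B hC hB, hP (hA.subtype_image hB) (hA.subtype_image hC),
    Set.inter_comm]

lemma memLp_restrictMeasure (hA : MeasurableSet A) (h0 : μ A ≠ 0) {f : α → ℝ}
    (hfm : Measurable f) (hf : MemLp f 2 μ) :
    MemLp (fun x : A => f x) 2 (restrictMeasure μ A) := by
  have hm : Measurable fun x : A => f x := hfm.comp measurable_subtype_coe
  refine MemLp.smul_measure ?_ (by simpa using h0)
  rw [memLp_two_iff_integrable_sq hm.aestronglyMeasurable]
  have h := (MeasurableEmbedding.subtype_coe hA).integrable_map_iff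
    (μ := μ.comap (Subtype.val : A → α)) (g := fun x => f x ^ 2)
  rw [map_comap_subtype_coe hA] at h
  exact h.1 hf.integrable_sq.integrableOn

lemma variance_restrictMeasure (hA : MeasurableSet A) {f : α → ℝ} (hfm : Measurable f) :
    variance (fun x : A => f x) (restrictMeasure μ A) =
      ⨍ x in A, (f x - ⨍ y in A, f y ∂μ) ^ 2 ∂μ := by
  have hm : Measurable fun x : A => f x := hfm.comp measurable_subtype_coe
  rw [variance_eq_integral hm.aemeasurable, integral_restrictMeasure hA f,
    ← integral_restrictMeasure hA fun x => (f x - ⨍ y in A, f y ∂μ) ^ 2]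

/-- The mass held at x contributes (f x − f x)² = 0, so only the jumps inside A remain. The
normalization of the restricted measure is undone by the factor `μ.real A`. -/
lemma ofReal_dirichletForm_restrict (hP : P.IsReversible μ) (hA : MeasurableSet A) (h0 : μ A ≠ 0)
    {f : α → ℝ} (hfm : Measurable f) (hf : MemLp f 2 μ) :
    ENNReal.ofReal (μ.real A * (2 *
      dirichletForm (restrictKernel P A hA) (restrictMeasure μ A) fun x : A => f x)) =
      ∫⁻ x in A, ∫⁻ y in A, ENNReal.ofReal ((f x - f y) ^ 2) ∂(P x) ∂μ := by
  have := isProbabilityMeasure_restrictMeasure hA h0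
  have hm : Measurable fun x : A => f x := hfm.comp measurable_subtype_coe
  rw [ENNReal.ofReal_mul measureReal_nonneg,
    ofReal_two_mul_dirichletForm (isReversible_restrictKernel hP hA).invariant
      hm (memLp_restrictMeasure hA h0 hfm hf)]
  have : ∀ x : A, ∫⁻ y, ENNReal.ofReal ((f x - f y) ^ 2) ∂(restrictKernel P A hA x) =
      ∫⁻ y in A, ENNReal.ofReal ((f x - f y) ^ 2) ∂(P x) := by
    intro x
    rw [restrictKernel_apply, lintegral_add_measure, lintegral_smul_measure,
      lintegral_dirac' _ (by fun_prop), lintegral_subtype_comap hA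
        (fun y => ENNReal.ofReal ((f x - f y) ^ 2))]
    simp
  simp_rw [this]
  rw [lintegral_restrictMeasure hA
      (fun x => ∫⁻ y in A, ENNReal.ofReal ((f x - f y) ^ 2) ∂(P x)), ← mul_assoc,
    measureReal_def, ENNReal.ofReal_toReal (measure_ne_top μ A),
    ENNReal.mul_inv_cancel h0 (measure_ne_top μ A), one_mul]

end Restrict

/-! ### Decomposition over a partition and the projected chain -/

section Partition

set_option linter.unusedSectionVars false

variable {α : Type*} [MeasurableSpace α] {P : Kernel α α} [IsMarkovKernel P]
  {μ : Measure α} [IsProbabilityMeasure μ] {J : ℕ} {A : Fin J → Set α}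

lemma lintegral_partition (hA : ∀ j, MeasurableSet (A j))
    (hd : Pairwise fun i j => Disjoint (A i) (A j)) (hc : ⋃ j, A j = Set.univ) {ν : Measure α}
    (F : α → ℝ≥0∞) : ∫⁻ x, F x ∂ν = ∑ j, ∫⁻ x in A j, F x ∂ν := by
  rw [← setLIntegral_univ, ← hc, lintegral_iUnion hA hd, tsum_fintype]

lemma integral_partition (hA : ∀ j, MeasurableSet (A j))
    (hd : Pairwise fun i j => Disjoint (A i) (A j)) (hc : ⋃ j, A j = Set.univ) {ν : Measure α}
    {F : α → ℝ} (hF : Integrable F ν) : ∫ x, F x ∂ν = ∑ j, ∫ x in A j, F x ∂ν := by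
  rw [← setIntegral_univ, ← hc, integral_iUnion_fintype hA hd fun _ => hF.integrableOn]

/-- The left side counts only the jumps that stay inside a cell; the jumps between cells, which
contribute nonnegatively, are discarded. -/
lemma sum_dirichletForm_restrict_le (hP : P.IsReversible μ) (hA : ∀ j, MeasurableSet (A j))
    (hd : Pairwise fun i j => Disjoint (A i) (A j)) (hc : ⋃ j, A j = Set.univ)
    (h0 : ∀ j, μ (A j) ≠ 0) {f : α → ℝ} (hfm : Measurable f) (hf : MemLp f 2 μ) :
    ∑ j, μ.real (A j) * dirichletForm (restrictKernel P (A j) (hA j))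
      (restrictMeasure μ (A j)) (fun x : A j => f x) ≤ dirichletForm P μ f := by
  have hnn : ∀ j, 0 ≤ dirichletForm (restrictKernel P (A j) (hA j))
      (restrictMeasure μ (A j)) (fun x : A j => f x) := fun j => by
    have := isProbabilityMeasure_restrictMeasure (hA j) (h0 j)
    exact dirichletForm_nonneg (isReversible_restrictKernel hP (hA j)).invariant
      (memLp_restrictMeasure (hA j) (h0 j) hfm hf)
  have h : ENNReal.ofReal (∑ j, μ.real (A j) * (2 *
      dirichletForm (restrictKernel P (A j) (hA j)) (restrictMeasure μ (A j))
        fun x : A j => f x)) ≤ ENNReal.ofReal (2 * dirichletForm P μ f) := by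
    rw [ENNReal.ofReal_sum_of_nonneg fun j _ =>
        mul_nonneg measureReal_nonneg (mul_nonneg zero_le_two (hnn j)),
      ofReal_two_mul_dirichletForm hP.invariant hfm hf, lintegral_partition hA hd hc]
    refine Finset.sum_le_sum fun j _ => ?_
    rw [ofReal_dirichletForm_restrict hP (hA j) (h0 j) hfm hf]
    exact lintegral_mono fun x => setLIntegral_le_lintegral _ _
  rw [ENNReal.ofReal_le_ofReal_iff
    (mul_nonneg zero_le_two (dirichletForm_nonneg hP.invariant hf))] at h
  have h2 : ∑ j, μ.real (A j) * (2 *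
      dirichletForm (restrictKernel P (A j) (hA j)) (restrictMeasure μ (A j))
        fun x : A j => f x) = 2 * ∑ j, μ.real (A j) *
      dirichletForm (restrictKernel P (A j) (hA j)) (restrictMeasure μ (A j))
        fun x : A j => f x := by
    rw [Finset.mul_sum]; exact Finset.sum_congr rfl fun j _ => by ring
  linarith

/-- The Poincaré inequality within the cells of a partition. -/
lemma mul_sum_setIntegral_le (hP : P.IsReversible μ) (hA : ∀ j, MeasurableSet (A j))
    (hd : Pairwise fun i j => Disjoint (A i) (A j)) (hc : ⋃ j, A j = Set.univ)
    (h0 : ∀ j, μ (A j) ≠ 0) {f : α → ℝ} (hfm : Measurable f) (hf : MemLp f 2 μ) {g : ℝ}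
    (hg : ∀ j, g ≤ gap (restrictKernel P (A j) (hA j)) (restrictMeasure μ (A j))) :
    g * ∑ j, ∫ x in A j, (f x - ⨍ y in A j, f y ∂μ) ^ 2 ∂μ ≤ dirichletForm P μ f := by
  refine le_trans ?_ (sum_dirichletForm_restrict_le hP hA hd hc h0 hfm hf)
  rw [Finset.mul_sum]
  refine Finset.sum_le_sum fun j _ => ?_
  have := isProbabilityMeasure_restrictMeasure (hA j) (h0 j)
  have h := gap_mul_variance_le (isReversible_restrictKernel hP (hA j)).invariant
    (memLp_restrictMeasure (hA j) (h0 j) hfm hf)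
  have hpos : 0 < μ.real (A j) :=
    ENNReal.toReal_pos (h0 j) (measure_ne_top _ _)
  have hv : ∫ x in A j, (f x - ⨍ y in A j, f y ∂μ) ^ 2 ∂μ =
      μ.real (A j) * variance (fun x : A j => f x) (restrictMeasure μ (A j)) := by
    rw [variance_restrictMeasure (hA j) hfm, setAverage_eq (f := fun x => (f x - _) ^ 2),
      smul_eq_mul, mul_inv_cancel_left₀ hpos.ne']
  rw [hv, mul_left_comm]
  exact mul_le_mul_of_nonneg_left
    ((mul_le_mul_of_nonneg_right (hg j) (variance_nonneg _ _)).trans h) hpos.le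

lemma projKernel_apply (i : Fin J) :
    projKernel P μ A i = ∑ j, projMatrix P μ A i j • Measure.dirac j := rfl

lemma lintegral_projKernel (i : Fin J) (F : Fin J → ℝ≥0∞) :
    ∫⁻ j, F j ∂(projKernel P μ A i) = ∑ j, projMatrix P μ A i j * F j := by
  simp [projKernel_apply]

lemma lintegral_projMeasure (F : Fin J → ℝ≥0∞) :
    ∫⁻ j, F j ∂(projMeasure μ A) = ∑ j, μ (A j) * F j := by
  simp [projMeasure]

lemma integral_projMeasure (F : Fin J → ℝ) :
    ∫ j, F j ∂(projMeasure μ A) = ∑ j, μ.real (A j) * F j := by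
  rw [projMeasure, integral_finsetSum_measure]
  · simp [integral_smul_measure, measureReal_def]
  · intro j _
    exact (integrable_dirac (by simp)).smul_measure (measure_ne_top _ _)

lemma measure_mul_projMatrix (h0 : ∀ j, μ (A j) ≠ 0) (i j : Fin J) :
    μ (A i) * projMatrix P μ A i j = ∫⁻ x in A i, P x (A j) ∂μ := by
  rw [projMatrix, ← mul_assoc, ENNReal.mul_inv_cancel (h0 i) (measure_ne_top _ _), one_mul]

lemma sum_measure_partition (hA : ∀ j, MeasurableSet (A j))
    (hd : Pairwise fun i j => Disjoint (A i) (A j)) (hc : ⋃ j, A j = Set.univ) (ν : Measure α) :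
    ∑ j, ν (A j) = ν Set.univ := by
  simpa using (lintegral_partition hA hd hc (ν := ν) fun _ => 1).symm

lemma isMarkovKernel_projKernel (hA : ∀ j, MeasurableSet (A j))
    (hd : Pairwise fun i j => Disjoint (A i) (A j)) (hc : ⋃ j, A j = Set.univ)
    (h0 : ∀ j, μ (A j) ≠ 0) : IsMarkovKernel (projKernel P μ A) := by
  refine ⟨fun i => ⟨?_⟩⟩
  have h : ∑ j, projMatrix P μ A i j = 1 := by
    simp only [projMatrix]
    rw [← Finset.mul_sum, ← lintegral_finsetSum _ fun j _ => P.measurable_coe (hA j)]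
    simp [sum_measure_partition hA hd hc, ENNReal.inv_mul_cancel (h0 i) (measure_ne_top _ _)]
  simp [projKernel_apply, h]

lemma isProbabilityMeasure_projMeasure (hA : ∀ j, MeasurableSet (A j))
    (hd : Pairwise fun i j => Disjoint (A i) (A j)) (hc : ⋃ j, A j = Set.univ) :
    IsProbabilityMeasure (projMeasure μ A) :=
  ⟨by simp [projMeasure, sum_measure_partition hA hd hc]⟩

lemma isReversible_projKernel (hP : P.IsReversible μ) (hA : ∀ j, MeasurableSet (A j))
    (h0 : ∀ j, μ (A j) ≠ 0) : (projKernel P μ A).IsReversible (projMeasure μ A) := by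
  have key : ∀ B C : Set (Fin J), ∫⁻ i in B, projKernel P μ A i C ∂(projMeasure μ A) =
      ∑ i, ∑ j, (∫⁻ x in A i, P x (A j) ∂μ) * (B.indicator 1 i * C.indicator 1 j) := by
    intro B C
    rw [← lintegral_indicator (MeasurableSet.of_discrete), lintegral_projMeasure]
    refine Finset.sum_congr rfl fun i _ => ?_
    have hB : B.indicator (fun i => projKernel P μ A i C) i =
        B.indicator 1 i * projKernel P μ A i C := by
      by_cases hi : i ∈ B <;> simp [hi]
    rw [hB, ← lintegral_indicator_one (μ := projKernel P μ A i) (s := C) .of_discrete,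
      lintegral_projKernel, Finset.mul_sum, Finset.mul_sum]
    refine Finset.sum_congr rfl fun j _ => ?_
    rw [← measure_mul_projMatrix h0]
    ring
  intro B C _ _
  rw [key, key, Finset.sum_comm]
  refine Finset.sum_congr rfl fun i _ => Finset.sum_congr rfl fun j _ => ?_
  rw [hP (hA j) (hA i), mul_comm (B.indicator 1 j)]

/-- The function taking the value `a j` on the cell `A j`. -/
noncomputable def cellFun (A : Fin J → Set α) (a : Fin J → ℝ) (x : α) : ℝ :=
  ∑ j, (A j).indicator (fun _ => a j) x

lemma measurable_cellFun (hA : ∀ j, MeasurableSet (A j)) (a : Fin J → ℝ) :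
    Measurable (cellFun A a) :=
  Finset.measurable_sum _ fun j _ => measurable_const.indicator (hA j)

lemma cellFun_of_mem (hd : Pairwise fun i j => Disjoint (A i) (A j)) (a : Fin J → ℝ) {x : α}
    {j : Fin J} (hx : x ∈ A j) : cellFun A a x = a j := by
  rw [cellFun, Finset.sum_eq_single j]
  · exact Set.indicator_of_mem hx _
  · intro i _ hij
    exact Set.indicator_of_notMem (fun hi => Set.disjoint_left.1 (hd hij) hi hx) _
  · simp

lemma memLp_cellFun (hA : ∀ j, MeasurableSet (A j)) (a : Fin J → ℝ) :
    MemLp (cellFun A a) 2 μ :=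
  memLp_finsetSum _ fun j _ => (memLp_const (a j)).indicator (hA j)

/-- For a function constant on cells, the squared difference across a jump depends only on the two
cells, and `μ (A i) * projMatrix P μ A i j` is the stationary mass of jumps from `A i` to `A j`. -/
lemma dirichletForm_projKernel (hP : P.IsReversible μ) (hA : ∀ j, MeasurableSet (A j))
    (hd : Pairwise fun i j => Disjoint (A i) (A j)) (hc : ⋃ j, A j = Set.univ)
    (h0 : ∀ j, μ (A j) ≠ 0) (a : Fin J → ℝ) :
    dirichletForm (projKernel P μ A) (projMeasure μ A) a = dirichletForm P μ (cellFun A a) := by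
  have := isMarkovKernel_projKernel (P := P) hA hd hc h0
  have := isProbabilityMeasure_projMeasure (μ := μ) hA hd hc
  have hi := (isReversible_projKernel hP hA h0).invariant
  have ha : MemLp a 2 (projMeasure μ A) := MemLp.of_discrete
  have hu := memLp_cellFun (μ := μ) hA a
  have h : ENNReal.ofReal (2 * dirichletForm (projKernel P μ A) (projMeasure μ A) a) =
      ENNReal.ofReal (2 * dirichletForm P μ (cellFun A a)) := by
    rw [ofReal_two_mul_dirichletForm hi (measurable_of_finite a) ha,
      ofReal_two_mul_dirichletForm hP.invariant (measurable_cellFun hA a) hu,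
      lintegral_projMeasure, lintegral_partition hA hd hc]
    refine Finset.sum_congr rfl fun i _ => ?_
    rw [lintegral_projKernel, Finset.mul_sum]
    have hin : ∫⁻ x in A i, ∫⁻ y, ENNReal.ofReal ((cellFun A a x - cellFun A a y) ^ 2) ∂(P x) ∂μ =
        ∫⁻ x in A i, ∑ j, P x (A j) * ENNReal.ofReal ((a i - a j) ^ 2) ∂μ := by
      refine setLIntegral_congr_fun (hA i) fun x hx => ?_
      rw [lintegral_partition hA hd hc]
      refine Finset.sum_congr rfl fun j _ => ?_
      rw [setLIntegral_congr_fun (hA j) (g := fun _ => ENNReal.ofReal ((a i - a j) ^ 2))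
        (fun y hy => by simp only [cellFun_of_mem hd a hx, cellFun_of_mem hd a hy]),
        setLIntegral_const, mul_comm]
    rw [hin, lintegral_finsetSum _ fun j _ => (P.measurable_coe (hA j)).mul_const _]
    refine Finset.sum_congr rfl fun j _ => ?_
    rw [lintegral_mul_const _ (P.measurable_coe (hA j)), ← measure_mul_projMatrix h0, mul_assoc]
  have h1 := dirichletForm_nonneg hi ha
  have h2 := dirichletForm_nonneg hP.invariant hu
  rw [ENNReal.ofReal_eq_ofReal_iff (by positivity) (by positivity)] at h
  linarith

/-- The Poincaré inequality between the cells of a partition. -/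
lemma gap_projKernel_mul_sum_le (hP : P.IsReversible μ) (hA : ∀ j, MeasurableSet (A j))
    (hd : Pairwise fun i j => Disjoint (A i) (A j)) (hc : ⋃ j, A j = Set.univ)
    (h0 : ∀ j, μ (A j) ≠ 0) {f : α → ℝ} (hf : MemLp f 2 μ) (a : Fin J → ℝ) :
    gap (projKernel P μ A) (projMeasure μ A) *
        ∑ j, μ.real (A j) * (a j - ∑ i, μ.real (A i) * a i) ^ 2 ≤
      2 * dirichletForm P μ f + 4 * ∑ j, ∫ x in A j, (f x - a j) ^ 2 ∂μ := by
  have := isMarkovKernel_projKernel (P := P) hA hd hc h0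
  have := isProbabilityMeasure_projMeasure (μ := μ) hA hd hc
  have ha : MemLp a 2 (projMeasure μ A) := MemLp.of_discrete
  have h := gap_mul_variance_le (isReversible_projKernel hP hA h0).invariant ha
  rw [variance_eq_integral (measurable_of_finite a).aemeasurable, integral_projMeasure,
    integral_projMeasure, dirichletForm_projKernel hP hA hd hc h0] at h
  refine h.trans ?_
  have hu := memLp_cellFun (μ := μ) hA a
  -- The step function is f plus this remainder; the 4 is the 2 of `dirichletForm_add_le` times the
  -- 2 of `dirichletForm_le_two_mul`.
  have hv : MemLp (cellFun A a - f) 2 μ := hu.sub hf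
  have h1 := dirichletForm_add_le hP.invariant hf hv
  have h2 := dirichletForm_le_two_mul hP.invariant hv
  rw [add_sub_cancel] at h1
  have h3 : ∫ x, (cellFun A a - f) x ^ 2 ∂μ = ∑ j, ∫ x in A j, (f x - a j) ^ 2 ∂μ := by
    rw [integral_partition hA hd hc hv.integrable_sq]
    refine Finset.sum_congr rfl fun j _ => setIntegral_congr_fun (hA j) fun x hx => ?_
    simp only [Pi.sub_apply, cellFun_of_mem hd a hx]
    ring
  rw [h3] at h2
  linarith

end Partition

/-! ### The tempering measure and its two moves -/

section Levels

set_option linter.unusedSectionVars false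

variable {X : Type*} [MeasurableSpace X] {lam : Measure X} {N : ℕ}
  {p : Fin (N + 1) → X → ℝ≥0}

lemma isProbabilityMeasure_densityMeasure {q : X → ℝ≥0} (h : ∫⁻ z, (q z : ℝ≥0∞) ∂lam = 1) :
    IsProbabilityMeasure (densityMeasure lam q) :=
  ⟨by rw [densityMeasure, withDensity_apply _ .univ, Measure.restrict_univ, h]⟩

lemma lintegral_densityMeasure {q : X → ℝ≥0} (hq : Measurable q) {F : X → ℝ≥0∞}
    (hF : Measurable F) : ∫⁻ z, F z ∂(densityMeasure lam q) = ∫⁻ z, q z * F z ∂lam := by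
  rw [densityMeasure, lintegral_withDensity_eq_lintegral_mul _ hq.coe_nnreal_ennreal hF]
  rfl

lemma ae_ne_zero_densityMeasure {q : X → ℝ≥0} (hq : Measurable q) :
    ∀ᵐ z ∂(densityMeasure lam q), q z ≠ 0 := by
  rw [densityMeasure, ae_withDensity_iff hq.coe_nnreal_ennreal]
  exact ae_of_all _ fun z hz => by simpa using hz

lemma isProbabilityMeasure_stMeasure (hp_one : ∀ k, ∫⁻ z, (p k z : ℝ≥0∞) ∂lam = 1) :
    IsProbabilityMeasure (stMeasure lam p) := by
  have h : ∀ k, (densityMeasure lam (p k)) Set.univ = 1 := fun k =>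
    (isProbabilityMeasure_densityMeasure (hp_one k)).measure_univ
  refine ⟨?_⟩
  simp only [stMeasure, Measure.finsetSum_apply, Measure.smul_apply, smul_eq_mul,
    Measure.map_apply measurable_prodMk_right MeasurableSet.univ, Set.preimage_univ, h, mul_one,
    Finset.sum_const, Finset.card_univ, Fintype.card_fin, nsmul_eq_mul, Nat.cast_add, Nat.cast_one]
  exact ENNReal.mul_inv_cancel (by simp) (by finiteness)

lemma lintegral_stMeasure {F : X × Fin (N + 1) → ℝ≥0∞} (hF : Measurable F) :
    ∫⁻ x, F x ∂(stMeasure lam p) =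
      ((N : ℝ≥0∞) + 1)⁻¹ * ∑ k, ∫⁻ z, F (z, k) ∂(densityMeasure lam (p k)) := by
  simp only [stMeasure, lintegral_finsetSum_measure, lintegral_smul_measure, smul_eq_mul,
    lintegral_map hF measurable_prodMk_right, Finset.mul_sum]

/-- This domination transfers square integrability from the tempering measure to each level. -/
lemma map_level_le (k : Fin (N + 1)) :
    (densityMeasure lam (p k)).map (fun z => (z, k)) ≤ ((N : ℝ≥0∞) + 1) • stMeasure lam p := by
  have h : ((N : ℝ≥0∞) + 1) • stMeasure lam p =
      ∑ k, (densityMeasure lam (p k)).map fun z => (z, k) := by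
    rw [stMeasure, Finset.smul_sum]
    refine Finset.sum_congr rfl fun k _ => ?_
    rw [smul_smul, ENNReal.mul_inv_cancel (by simp) (by finiteness), one_smul]
  rw [h]
  refine Measure.le_iff.2 fun s _ => ?_
  rw [Measure.finsetSum_apply]
  exact Finset.single_le_sum_of_canonicallyOrdered
    (f := fun k => (densityMeasure lam (p k)).map (fun z => (z, k)) s) (Finset.mem_univ k)

lemma memLp_level {f : X × Fin (N + 1) → ℝ} (hf : MemLp f 2 (stMeasure lam p))
    (k : Fin (N + 1)) : MemLp (fun z => f (z, k)) 2 (densityMeasure lam (p k)) := by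
  have h := hf.of_measure_le_smul (by finiteness) (map_level_le k)
  exact (memLp_map_measure_iff h.aestronglyMeasurable measurable_prodMk_right.aemeasurable).1 h

lemma integral_stMeasure {F : X × Fin (N + 1) → ℝ} (hF : Integrable F (stMeasure lam p)) :
    ∫ x, F x ∂(stMeasure lam p) =
      ((N : ℝ) + 1)⁻¹ * ∑ k, ∫ z, F (z, k) ∂(densityMeasure lam (p k)) := by
  have h := hF
  rw [stMeasure, integrable_finsetSum_measure] at h
  rw [stMeasure, integral_finsetSum_measure h, Finset.mul_sum]
  refine Finset.sum_congr rfl fun k hk => ?_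
  have hm := hF.of_measure_le_smul (by finiteness) (map_level_le k)
  rw [integral_smul_measure, integral_map measurable_prodMk_right.aemeasurable
    hm.aestronglyMeasurable, smul_eq_mul]
  congr 1
  rw [ENNReal.toReal_inv, ENNReal.toReal_add (by simp) (by simp)]
  simp

section StateUpdate

variable {T : Fin (N + 1) → Kernel X X} [∀ k, IsMarkovKernel (T k)]

lemma stateUpdate_apply (z : X) (k : Fin (N + 1)) :
    stateUpdate T (z, k) = (T k z).map fun z => (z, k) := rfl

instance isMarkovKernel_stateUpdate : IsMarkovKernel (stateUpdate T) :=
  ⟨fun x => Measure.isProbabilityMeasure_map (μ := T x.2 x.1)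
    (measurable_prodMk_right (y := x.2)).aemeasurable⟩

lemma isReversible_stateUpdate (hT : ∀ k, (T k).IsReversible (densityMeasure lam (p k))) :
    (stateUpdate T).IsReversible (stMeasure lam p) := by
  have key : ∀ B C : Set (X × Fin (N + 1)), MeasurableSet B → MeasurableSet C →
      ∫⁻ x in B, stateUpdate T x C ∂(stMeasure lam p) = ((N : ℝ≥0∞) + 1)⁻¹ *
        ∑ k, ∫⁻ z in (fun z => (z, k)) ⁻¹' B, T k z ((fun z => (z, k)) ⁻¹' C)
          ∂(densityMeasure lam (p k)) := by
    intro B C hB hC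
    rw [← lintegral_indicator hB,
      lintegral_stMeasure (((stateUpdate T).measurable_coe hC).indicator hB)]
    congr 1
    refine Finset.sum_congr rfl fun k _ => ?_
    rw [← lintegral_indicator (measurable_prodMk_right hB)]
    refine lintegral_congr fun z => ?_
    simp only [Set.indicator, Set.mem_preimage, stateUpdate_apply,
      Measure.map_apply measurable_prodMk_right hC]
    rfl
  intro B C hB hC
  rw [key B C hB hC, key C B hC hB]
  congr 1
  exact Finset.sum_congr rfl fun k _ =>
    hT k (measurable_prodMk_right hB) (measurable_prodMk_right hC)

/-- The move never changes the level, so the form is the average of the forms at the separate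
levels. -/
lemma dirichletForm_stateUpdate (hp_one : ∀ k, ∫⁻ z, (p k z : ℝ≥0∞) ∂lam = 1)
    (hT : ∀ k, (T k).IsReversible (densityMeasure lam (p k)))
    {f : X × Fin (N + 1) → ℝ} (hfm : Measurable f) (hf : MemLp f 2 (stMeasure lam p)) :
    dirichletForm (stateUpdate T) (stMeasure lam p) f = ((N : ℝ) + 1)⁻¹ *
      ∑ k, dirichletForm (T k) (densityMeasure lam (p k)) fun z => f (z, k) := by
  have := isProbabilityMeasure_stMeasure hp_one
  have hi : Integrable (fun x => f x * (f x - ∫ y, f y ∂(stateUpdate T x))) (stMeasure lam p) :=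
    hf.integrable_mul (hf.sub (memLp_integral_kernel (isReversible_stateUpdate hT).invariant hf))
  rw [dirichletForm, integral_stMeasure hi]
  congr 1
  refine Finset.sum_congr rfl fun k _ => ?_
  rw [dirichletForm]
  congr 1
  ext z
  rw [stateUpdate_apply, integral_map measurable_prodMk_right.aemeasurable
    hfm.aestronglyMeasurable]

end StateUpdate

section LevelUpdate

variable (hp : ∀ k, Measurable (p k))

lemma levelUpdate_apply (x : X × Fin (N + 1)) :
    levelUpdate p hp x = if ∑ m, p m x.1 = 0 then Measure.dirac x
      else ∑ l, ((p l x.1 / ∑ m, p m x.1 : ℝ≥0) : ℝ≥0∞) • Measure.dirac (x.1, l) := rfl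

lemma sum_div_sum_eq_one {z : X} (hz : ∑ m, p m z ≠ 0) :
    ∑ l, p l z / ∑ m, p m z = 1 := by
  rw [← Finset.sum_div, div_self hz]

instance isMarkovKernel_levelUpdate : IsMarkovKernel (levelUpdate p hp) := by
  refine ⟨fun x => ⟨?_⟩⟩
  rw [levelUpdate_apply]
  split_ifs with h
  · simp
  · simp only [Measure.finsetSum_apply, Measure.smul_apply, smul_eq_mul, measure_univ, mul_one]
    rw [← ENNReal.ofNNReal_finsetSum, sum_div_sum_eq_one h, ENNReal.coe_one]

lemma integral_levelUpdate_of_ne {f : X × Fin (N + 1) → ℝ} (hf : Measurable f) {z : X}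
    (hz : ∑ m, p m z ≠ 0) (k : Fin (N + 1)) :
    ∫ y, f y ∂(levelUpdate p hp (z, k)) =
      ∑ l, ((p l z / ∑ m, p m z : ℝ≥0) : ℝ) * f (z, l) := by
  rw [levelUpdate_apply, if_neg hz, integral_finsetSum_measure]
  · refine Finset.sum_congr rfl fun l _ => ?_
    rw [integral_smul_measure, integral_dirac' _ _ hf.stronglyMeasurable]
    simp
  · intro l _
    exact (integrable_dirac' hf.stronglyMeasurable (by simp)).smul_measure (by simp)

/-- Resampling the level yields a mean that depends on z alone, so a second resampling changes
nothing; with reversibility this makes the level update an orthogonal projection. -/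
lemma integral_levelUpdate_idem {f : X × Fin (N + 1) → ℝ} (hf : Measurable f)
    (x : X × Fin (N + 1)) :
    ∫ y, ∫ z, f z ∂(levelUpdate p hp y) ∂(levelUpdate p hp x) =
      ∫ z, f z ∂(levelUpdate p hp x) := by
  have hm : Measurable fun y => ∫ z, f z ∂(levelUpdate p hp y) :=
    hf.stronglyMeasurable.integral_kernel.measurable
  obtain ⟨z, k⟩ := x
  by_cases hz : ∑ m, p m z = 0
  · have : levelUpdate p hp (z, k) = Measure.dirac (z, k) := by
      rw [levelUpdate_apply, if_pos hz]
    nth_rw 1 [this]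
    rw [integral_dirac' _ _ hm.stronglyMeasurable]
  · rw [integral_levelUpdate_of_ne hp hm hz]
    simp only [integral_levelUpdate_of_ne hp hf hz]
    rw [← Finset.sum_mul, ← NNReal.coe_sum, sum_div_sum_eq_one hz, NNReal.coe_one, one_mul]

/-- The density of moving from level k to level l at z is proportional to π_k π_l / ∑ π_m, which is
symmetric in k and l. -/
lemma isReversible_levelUpdate : (levelUpdate p hp).IsReversible (stMeasure lam p) := by
  have hs : Measurable fun z => ∑ m, p m z := Finset.measurable_sum _ fun m _ => hp m
  have key : ∀ B C : Set (X × Fin (N + 1)), MeasurableSet B → MeasurableSet C →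
      ∫⁻ x in B, levelUpdate p hp x C ∂(stMeasure lam p) = ((N : ℝ≥0∞) + 1)⁻¹ *
        ∫⁻ z, ∑ k, ∑ l, ((p k z * p l z / ∑ m, p m z : ℝ≥0) : ℝ≥0∞) *
          (B.indicator 1 (z, k) * C.indicator 1 (z, l)) ∂lam := by
    intro B C hB hC
    have hmeas := ((levelUpdate p hp).measurable_coe hC).indicator hB
    rw [← lintegral_indicator hB, lintegral_stMeasure hmeas, lintegral_finsetSum]
    · congr 1
      refine Finset.sum_congr rfl fun k _ => ?_
      rw [lintegral_densityMeasure (hp k) (F := fun z => B.indicator _ (z, k))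
        (hmeas.comp measurable_prodMk_right)]
      refine lintegral_congr fun z => ?_
      -- Where the move holds by convention, the weight `p k z` vanishes, so the convention is
      -- invisible.
      by_cases hz : ∑ m, p m z = 0
      · have : p k z = 0 := by
          simpa using (Finset.sum_eq_zero_iff.1 hz) k (Finset.mem_univ k)
        simp [this]
      · by_cases hk : (z, k) ∈ B
        · simp only [Set.indicator_of_mem hk, levelUpdate_apply, if_neg hz,
            Measure.finsetSum_apply, Measure.smul_apply, smul_eq_mul, Finset.mul_sum,
            Measure.dirac_apply' _ hC, Pi.one_apply, one_mul]
          refine Finset.sum_congr rfl fun l _ => ?_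
          rw [← mul_assoc, ← ENNReal.coe_mul, mul_div_assoc]
        · simp [hk]
    · intro k _
      refine Finset.measurable_sum _ fun l _ => Measurable.mul ?_ (Measurable.mul ?_ ?_)
      · exact (((hp k).mul (hp l)).div hs).coe_nnreal_ennreal
      · exact (measurable_one.indicator hB).comp measurable_prodMk_right
      · exact (measurable_one.indicator hC).comp measurable_prodMk_right
  intro B C hB hC
  rw [key B C hB hC, key C B hC hB]
  congr 1
  refine lintegral_congr fun z => ?_
  rw [Finset.sum_comm]
  refine Finset.sum_congr rfl fun k _ => Finset.sum_congr rfl fun l _ => ?_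
  rw [mul_comm (p l z), mul_comm (B.indicator 1 (z, l))]

end LevelUpdate

end Levels

/-! ### Paths along the levels -/

section Path

variable {N : ℕ}

/-- The factors of the steps between i and k telescope to a bound on q i / q k; the remaining
factors are at most 1, so the full product lies below this partial one. -/
lemma mul_le_of_le_prod_min {q : Fin (N + 1) → ℝ} (hq : ∀ k, 0 < q k) {γ : ℝ}
    (hγ : γ ≤ ∏ m : Fin N, min 1 (q m.castSucc / q m.succ)) {i k : Fin (N + 1)} (hik : i ≤ k) :
    γ * q k ≤ q i := by
  set r : Fin N → ℝ := fun m => min 1 (q m.castSucc / q m.succ) with hr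
  have hr0 : ∀ m, 0 ≤ r m := fun m => le_min zero_le_one (div_pos (hq _) (hq _)).le
  have hr1 : ∀ m, r m ≤ 1 := fun m => min_le_left _ _
  -- S is the set of steps used so far; keeping it strictly below k guarantees that the next step is
  -- not yet in it.
  have h : ∃ S : Finset (Fin N), (∀ m ∈ S, m.castSucc < k) ∧ (∏ m ∈ S, r m) * q k ≤ q i := by
    induction k using Fin.induction with
    | zero =>
      have : i = 0 := Fin.le_zero_iff.1 hik
      exact ⟨∅, by simp, by simp [this]⟩
    | succ k ih =>
      rcases hik.eq_or_lt with rfl | hlt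
      · exact ⟨∅, by simp, by simp⟩
      · obtain ⟨S, hS, hle⟩ := ih (Fin.le_castSucc_iff.2 hlt)
        have hk : k ∉ S := fun h => lt_irrefl _ (hS k h)
        refine ⟨insert k S, ?_, ?_⟩
        · intro m hm
          rcases Finset.mem_insert.1 hm with rfl | hm
          · exact Fin.castSucc_lt_succ
          · exact (hS m hm).trans Fin.castSucc_lt_succ
        · rw [Finset.prod_insert hk]
          have h1 : r k * q k.succ ≤ q k.castSucc :=
            (le_div_iff₀ (hq _)).1 (min_le_right _ _)
          calc r k * (∏ m ∈ S, r m) * q k.succ = (∏ m ∈ S, r m) * (r k * q k.succ) := by ring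
            _ ≤ (∏ m ∈ S, r m) * q k.castSucc :=
              mul_le_mul_of_nonneg_left h1 (Finset.prod_nonneg fun m _ => hr0 m)
            _ ≤ q i := hle
  obtain ⟨S, -, hle⟩ := h
  refine le_trans (mul_le_mul_of_nonneg_right (hγ.trans ?_) (hq k).le) hle
  rw [← Finset.prod_mul_prod_compl S r]
  exact mul_le_of_le_one_right (Finset.prod_nonneg fun m _ => hr0 m)
    (Finset.prod_le_one (fun m _ => hr0 m) fun m _ => hr1 m)

/-- Cauchy–Schwarz for the k + 1 increments leading from c to a 0 and then up to a k. -/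
lemma sq_sub_le_path (a : Fin (N + 1) → ℝ) (c : ℝ) (k : Fin (N + 1)) :
    (a k - c) ^ 2 ≤ ((k : ℕ) + 1 : ℝ) * ((a 0 - c) ^ 2 +
      ∑ m : Fin N with m.castSucc < k, (a m.castSucc - a m.succ) ^ 2) := by
  induction k using Fin.induction with
  | zero => simp
  | succ k ih =>
    have hS : (Finset.univ.filter fun m : Fin N => m.castSucc < k.succ) =
        insert k (Finset.univ.filter fun m : Fin N => m.castSucc < k.castSucc) := by
      ext m
      simp only [Finset.mem_filter, Finset.mem_univ, true_and, Finset.mem_insert, Fin.lt_def,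
        Fin.val_castSucc, Fin.val_succ, Fin.ext_iff]
      omega
    rw [hS, Finset.sum_insert (by simp)]
    set Y := ∑ m : Fin N with m.castSucc < k.castSucc, (a m.castSucc - a m.succ) ^ 2
    set x := a k.castSucc - c
    set y := a k.castSucc - a k.succ
    have hx : a k.succ - c = x - y := by ring
    rw [hx]
    simp only [Fin.val_castSucc, Fin.val_succ, Nat.cast_add, Nat.cast_one] at ih ⊢
    set t : ℝ := (k : ℕ) + 1 with ht
    have htp : 0 < t := by positivity
    -- The gap in t(x − y)² ≤ (t + 1)(x² + ty²) is exactly (x + ty)².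
    have h1 : t * (x - y) ^ 2 ≤ t * ((t + 1) * ((a 0 - c) ^ 2 + (y ^ 2 + Y))) := by
      nlinarith [sq_nonneg (x + t * y), mul_le_mul_of_nonneg_left ih (by positivity : 0 ≤ t + 1)]
    exact le_of_mul_le_mul_left h1 htp

/-- Transport of weighted squared deviations along the levels to level `0`. -/
lemma mul_sum_sq_sub_le {q : Fin (N + 1) → ℝ} (hq : ∀ k, 0 ≤ q k) {γ : ℝ}
    (hγ : ∀ i k, i ≤ k → γ * q k ≤ q i) (hγ0 : 0 ≤ γ) (a : Fin (N + 1) → ℝ) (c : ℝ) :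
    γ * ∑ k, q k * (a k - c) ^ 2 ≤ ((N : ℝ) + 1) ^ 2 * (q 0 * (a 0 - c) ^ 2 +
      ∑ m : Fin N, q m.castSucc * (a m.castSucc - a m.succ) ^ 2) := by
  set Z := q 0 * (a 0 - c) ^ 2 + ∑ m : Fin N, q m.castSucc * (a m.castSucc - a m.succ) ^ 2
  have hk : ∀ k ∈ Finset.univ, γ * (q k * (a k - c) ^ 2) ≤ ((N : ℝ) + 1) * Z := by
    intro k _
    have hkN : ((k : ℕ) : ℝ) + 1 ≤ (N : ℝ) + 1 := by
      have : (k : ℕ) ≤ N := Nat.lt_succ_iff.1 k.2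
      have : ((k : ℕ) : ℝ) ≤ N := by exact_mod_cast this
      linarith
    have h := sq_sub_le_path a c k
    have hnn : 0 ≤ (a 0 - c) ^ 2 +
        ∑ m : Fin N with m.castSucc < k, (a m.castSucc - a m.succ) ^ 2 :=
      add_nonneg (sq_nonneg _) (Finset.sum_nonneg fun _ _ => sq_nonneg _)
    calc γ * (q k * (a k - c) ^ 2) = (γ * q k) * (a k - c) ^ 2 := by ring
      _ ≤ (γ * q k) * (((N : ℝ) + 1) * ((a 0 - c) ^ 2 +
          ∑ m : Fin N with m.castSucc < k, (a m.castSucc - a m.succ) ^ 2)) :=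
        mul_le_mul_of_nonneg_left (h.trans (mul_le_mul_of_nonneg_right hkN hnn))
          (mul_nonneg hγ0 (hq k))
      _ = ((N : ℝ) + 1) * ((γ * q k) * (a 0 - c) ^ 2 +
          ∑ m : Fin N with m.castSucc < k, (γ * q k) * (a m.castSucc - a m.succ) ^ 2) := by
        rw [← Finset.mul_sum]; ring
      _ ≤ ((N : ℝ) + 1) * Z := by
        refine mul_le_mul_of_nonneg_left (add_le_add ?_ ?_) (by positivity)
        · exact mul_le_mul_of_nonneg_right (hγ 0 k (Fin.zero_le k)) (sq_nonneg _)
        · refine le_trans (Finset.sum_le_sum fun m hm => mul_le_mul_of_nonneg_right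
            (hγ m.castSucc k (Finset.mem_filter.1 hm).2.le) (sq_nonneg _)) ?_
          exact Finset.sum_le_sum_of_subset_of_nonneg (Finset.filter_subset _ _)
            fun m _ _ => mul_nonneg (hq _) (sq_nonneg _)
  -- The path length gave one factor N + 1; summing over the levels k gives the other.
  rw [Finset.mul_sum]
  refine (Finset.sum_le_sum hk).trans_eq ?_
  simp
  ring

/-- Each level is an endpoint of at most two steps. -/
lemma sum_castSucc_add_succ_le {x : Fin (N + 1) → ℝ} (hx : ∀ k, 0 ≤ x k) :
    ∑ m : Fin N, (x m.castSucc + x m.succ) ≤ 2 * ∑ k, x k := by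
  rw [Finset.sum_add_distrib, two_mul]
  refine add_le_add ?_ ?_
  · rw [Fin.sum_univ_castSucc]; linarith [hx (Fin.last N)]
  · rw [Fin.sum_univ_succ]; linarith [hx 0]

end Path

/-! ### Comparing adjacent levels through the overlap of their densities -/

section Overlap

variable {X : Type*} [MeasurableSpace X] {lam : Measure X}

lemma densityMeasure_mono {q r : X → ℝ≥0} (h : ∀ z, q z ≤ r z) :
    densityMeasure lam q ≤ densityMeasure lam r :=
  withDensity_mono (ae_of_all _ fun z => ENNReal.coe_le_coe.2 (h z))

lemma setIntegral_eq_densityMeasure {q : X → ℝ≥0} (hq : Measurable q) {B : Set X}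
    (hB : MeasurableSet B) : ∫ z in B, (q z : ℝ) ∂lam = (densityMeasure lam q).real B := by
  rw [measureReal_def, densityMeasure, withDensity_apply _ hB,
    ← integral_toReal hq.coe_nnreal_ennreal.aemeasurable (ae_of_all _ fun _ => by simp)]
  simp

/-- Comparison of two constants through the overlap of two densities. -/
lemma overlap_mul_sq_sub_le {q r : X → ℝ≥0} [IsProbabilityMeasure (densityMeasure lam q)]
    [IsProbabilityMeasure (densityMeasure lam r)] (B : Set X) {f h m : X → ℝ}
    (hf : MemLp f 2 (densityMeasure lam q)) (hh : MemLp h 2 (densityMeasure lam r))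
    (hmq : MemLp m 2 (densityMeasure lam q)) (hmr : MemLp m 2 (densityMeasure lam r)) (a b : ℝ) :
    (densityMeasure lam fun z => min (q z) (r z)).real B * (a - b) ^ 2 ≤
      4 * (∫ z in B, (f z - a) ^ 2 ∂(densityMeasure lam q) +
        ∫ z in B, (f z - m z) ^ 2 ∂(densityMeasure lam q) +
        (∫ z in B, (h z - m z) ^ 2 ∂(densityMeasure lam r) +
          ∫ z in B, (h z - b) ^ 2 ∂(densityMeasure lam r))) := by
  set ν := densityMeasure lam fun z => min (q z) (r z) with hν
  have hνq : ν.restrict B ≤ (densityMeasure lam q).restrict B :=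
    Measure.restrict_mono le_rfl (densityMeasure_mono fun z => min_le_left _ _)
  have hνr : ν.restrict B ≤ (densityMeasure lam r).restrict B :=
    Measure.restrict_mono le_rfl (densityMeasure_mono fun z => min_le_right _ _)
  have : IsFiniteMeasure (ν.restrict B) := isFiniteMeasure_of_le _ hνq
  have i1 := ((hf.sub (memLp_const a)).integrable_sq).restrict (s := B)
  have i2 := ((hf.sub hmq).integrable_sq).restrict (s := B)
  have i3 := ((hh.sub hmr).integrable_sq).restrict (s := B)
  have i4 := ((hh.sub (memLp_const b)).integrable_sq).restrict (s := B)
  have nn : ∀ (F : X → ℝ) (κ : Measure X), 0 ≤ᵐ[κ] fun z => F z ^ 2 :=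
    fun F κ => ae_of_all _ fun z => sq_nonneg _
  have m1 := integral_mono_measure hνq (nn _ _) i1
  have m2 := integral_mono_measure hνq (nn _ _) i2
  have m3 := integral_mono_measure hνr (nn _ _) i3
  have m4 := integral_mono_measure hνr (nn _ _) i4
  have j1 := i1.mono_measure hνq
  have j2 := i2.mono_measure hνq
  have j3 := i3.mono_measure hνr
  have j4 := i4.mono_measure hνr
  simp only [Pi.sub_apply] at m1 m2 m3 m4 j1 j2 j3 j4
  -- a − b is a signed sum of the four deviations; the six squares supplied are the pairwise ones
  -- that prove (∑ sᵢ)² ≤ 4 ∑ sᵢ².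
  have key : ∫ z in B, (a - b) ^ 2 ∂ν ≤ ∫ z in B, 4 * ((f z - a) ^ 2 + (f z - m z) ^ 2 +
      ((h z - m z) ^ 2 + (h z - b) ^ 2)) ∂ν := by
    refine integral_mono (integrable_const _) (((j1.add j2).add (j3.add j4)).const_mul 4)
      fun z => ?_
    nlinarith [sq_nonneg ((f z - a) + (f z - m z)), sq_nonneg ((f z - a) - (h z - m z)),
      sq_nonneg ((f z - a) + (h z - b)), sq_nonneg ((f z - m z) + (h z - m z)),
      sq_nonneg ((f z - m z) - (h z - b)), sq_nonneg ((h z - m z) + (h z - b))]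
  have j12 : Integrable (fun z => (f z - a) ^ 2 + (f z - m z) ^ 2) (ν.restrict B) := j1.add j2
  have j34 : Integrable (fun z => (h z - m z) ^ 2 + (h z - b) ^ 2) (ν.restrict B) := j3.add j4
  rw [integral_const_mul, integral_add j12 j34, integral_add j1 j2,
    integral_add j3 j4, setIntegral_const, smul_eq_mul] at key
  linarith

/-- Bias–variance decomposition on B: the cross term vanishes because the deviation from the average
integrates to 0. -/
lemma setIntegral_sq_sub_eq {α : Type*} [MeasurableSpace α] {μ : Measure α}
    [IsProbabilityMeasure μ] {B : Set α} (h0 : μ B ≠ 0) {f : α → ℝ} (hf : MemLp f 2 μ) (c : ℝ) :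
    ∫ x in B, (f x - c) ^ 2 ∂μ = ∫ x in B, (f x - ⨍ y in B, f y ∂μ) ^ 2 ∂μ +
      μ.real B * (⨍ y in B, f y ∂μ - c) ^ 2 := by
  have hq : μ.real B ≠ 0 := (ENNReal.toReal_pos h0 (measure_ne_top _ _)).ne'
  set a := ⨍ y in B, f y ∂μ with ha
  have hfa : ∫ x in B, f x ∂μ = μ.real B * a := by
    rw [ha, setAverage_eq, smul_eq_mul, mul_inv_cancel_left₀ hq]
  have i1 : IntegrableOn (fun x => (f x - a) ^ 2) B μ :=
    (hf.sub (memLp_const a)).integrable_sq.integrableOn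
  have i2 : IntegrableOn (fun x => f x - a) B μ :=
    ((hf.sub (memLp_const a)).integrable (by norm_num)).integrableOn
  have hf1 : IntegrableOn f B μ := (hf.integrable (by norm_num)).integrableOn
  have h1 : ∫ x in B, (f x - a) ∂μ = 0 := by
    rw [integral_sub hf1 (integrable_const a), hfa, setIntegral_const, smul_eq_mul, sub_self]
  have : ∀ x, (f x - c) ^ 2 = (f x - a) ^ 2 + (2 * (a - c) * (f x - a) + (a - c) ^ 2) :=
    fun x => by ring
  simp_rw [this]
  have i3 : IntegrableOn (fun x => 2 * (a - c) * (f x - a) + (a - c) ^ 2) B μ :=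
    (i2.const_mul _).add (integrable_const _)
  rw [integral_add i1 i3,
    integral_add (i2.const_mul _) (integrable_const _), integral_const_mul, h1,
    setIntegral_const, smul_eq_mul]
  ring

end Overlap

/-! ### The Poincaré inequality for simulated tempering -/

section Main

variable {X : Type*} [MeasurableSpace X] {lam : Measure X} {N J : ℕ}
  {p : Fin (N + 1) → X → ℝ≥0} {A : Fin J → Set X}

lemma overlap_nonneg : 0 ≤ overlap lam p A := by
  refine Real.sInf_nonneg ?_
  rintro r ⟨k, l, j, -, rfl⟩
  exact div_nonneg (integral_nonneg fun _ => NNReal.coe_nonneg _) measureReal_nonneg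

lemma overlap_le (k l : Fin (N + 1)) (j : Fin J) (hkl : |((k : ℕ) : ℤ) - ((l : ℕ) : ℤ)| = 1) :
    overlap lam p A ≤ (∫ z in A j, ((min (p k z) (p l z) : ℝ≥0) : ℝ) ∂lam) /
      (densityMeasure lam (p k)).real (A j) := by
  refine csInf_le ⟨0, ?_⟩ ⟨k, l, j, hkl, rfl⟩
  rintro r ⟨k, l, j, -, rfl⟩
  exact div_nonneg (integral_nonneg fun _ => NNReal.coe_nonneg _) measureReal_nonneg

lemma overlap_mul_le (hp : ∀ k, Measurable (p k)) (hA : ∀ j, MeasurableSet (A j))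
    (hpos : ∀ k j, 0 < (densityMeasure lam (p k)).real (A j)) (m : Fin N) (j : Fin J) :
    overlap lam p A * (densityMeasure lam (p m.castSucc)).real (A j) ≤
      (densityMeasure lam fun z => min (p m.castSucc z) (p m.succ z)).real (A j) := by
  rw [← le_div_iff₀ (hpos _ j),
    ← setIntegral_eq_densityMeasure ((hp m.castSucc).min (hp m.succ)) (hA j)]
  exact overlap_le _ _ _ (by simp)

lemma overlap_le_one (hN : 1 ≤ N) (hp : ∀ k, Measurable (p k))
    (hp_one : ∀ k, ∫⁻ z, (p k z : ℝ≥0∞) ∂lam = 1) (hA : ∀ j, MeasurableSet (A j))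
    (hpos : ∀ k j, 0 < (densityMeasure lam (p k)).real (A j)) (j : Fin J) :
    overlap lam p A ≤ 1 := by
  -- Levels 0 and 1 are an adjacent pair against which the infimum can be tested.
  have h := overlap_mul_le hp hA hpos ⟨0, hN⟩ j
  have := isProbabilityMeasure_densityMeasure (hp_one (Fin.castSucc ⟨0, hN⟩))
  have h2 : (densityMeasure lam fun z => min (p (Fin.castSucc ⟨0, hN⟩) z)
      (p (Fin.succ ⟨0, hN⟩) z)).real (A j) ≤
        (densityMeasure lam (p (Fin.castSucc ⟨0, hN⟩))).real (A j) :=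
    ENNReal.toReal_mono (measure_ne_top _ _) (densityMeasure_mono (fun z => min_le_left _ _) _)
  exact le_of_mul_le_mul_right ((h.trans h2).trans_eq (one_mul _).symm) (hpos _ j)

lemma gammaA_nonneg : 0 ≤ gammaA lam p A :=
  Real.iInf_nonneg fun _ => Finset.prod_nonneg fun _ _ =>
    le_min zero_le_one (div_nonneg measureReal_nonneg measureReal_nonneg)

lemma gammaA_le (j : Fin J) : gammaA lam p A ≤ ∏ k : Fin N, min 1
    ((densityMeasure lam (p k.castSucc)).real (A j) /
      (densityMeasure lam (p k.succ)).real (A j)) :=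
  ciInf_le (Set.finite_range _).bddBelow j

lemma gammaA_le_one (j : Fin J) : gammaA lam p A ≤ 1 :=
  (gammaA_le j).trans (Finset.prod_le_one (fun _ _ =>
    le_min zero_le_one (div_nonneg measureReal_nonneg measureReal_nonneg))
    fun _ _ => min_le_left _ _)

/-- The variance of `f` under the tempering distribution, split into the variances within the
cells and the weighted deviations of the cell averages from a constant. -/
lemma variance_stMeasure_le (hp_one : ∀ k, ∫⁻ z, (p k z : ℝ≥0∞) ∂lam = 1)
    (hA : ∀ j, MeasurableSet (A j)) (hd : Pairwise fun i j => Disjoint (A i) (A j))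
    (hc : ⋃ j, A j = Set.univ) (h0 : ∀ k j, densityMeasure lam (p k) (A j) ≠ 0)
    {f : X × Fin (N + 1) → ℝ} (hf : MemLp f 2 (stMeasure lam p)) (c : ℝ) :
    ((N : ℝ) + 1) * variance f (stMeasure lam p) ≤
      ∑ k, ∑ j, ∫ z in A j, (f (z, k) - ⨍ y in A j, f (y, k) ∂(densityMeasure lam (p k))) ^ 2
        ∂(densityMeasure lam (p k)) +
      ∑ j, ∑ k, (densityMeasure lam (p k)).real (A j) *
        (⨍ y in A j, f (y, k) ∂(densityMeasure lam (p k)) - c) ^ 2 := by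
  have := isProbabilityMeasure_stMeasure hp_one
  have hfc : MemLp (fun x => f x - c) 2 (stMeasure lam p) := hf.sub (memLp_const c)
  -- The mean minimizes the second moment, so any c is allowed; it will be chosen as the mean at
  -- level 0.
  have hv : variance f (stMeasure lam p) ≤ ∫ x, (f x - c) ^ 2 ∂(stMeasure lam p) := by
    rw [← variance_sub_const hf.aestronglyMeasurable c]
    exact variance_le_expectation_sq hfc.aestronglyMeasurable
  rw [integral_stMeasure hfc.integrable_sq] at hv
  have hn : (0 : ℝ) < (N : ℝ) + 1 := by positivity
  refine (mul_le_mul_of_nonneg_left hv hn.le).trans_eq ?_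
  rw [mul_inv_cancel_left₀ hn.ne', Finset.sum_comm (γ := Fin J), ← Finset.sum_add_distrib]
  refine Finset.sum_congr rfl fun k _ => ?_
  have := isProbabilityMeasure_densityMeasure (hp_one k)
  rw [← Finset.sum_add_distrib, integral_partition hA hd hc (memLp_level hfc k).integrable_sq]
  exact Finset.sum_congr rfl fun j _ => setIntegral_sq_sub_eq (h0 k j) (memLp_level hf k) c

/-- The combination of the one-step estimates. -/
lemma combine_estimates {n V W B B0 D R S S0 W0 E γ δ G g : ℝ} (hn : 1 ≤ n)
    (hW : 0 ≤ W) (hB0 : 0 ≤ B0) (hD : 0 ≤ D) (hR : 0 ≤ R) (hS : 0 ≤ S)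
    (hγ0 : 0 ≤ γ) (hγ1 : γ ≤ 1) (hδ0 : 0 ≤ δ) (hδ1 : δ ≤ 1)
    (hG0 : 0 ≤ G) (hG2 : G ≤ 2) (hg0 : 0 ≤ g) (hg2 : g ≤ 2) (hS0 : S0 ≤ S) (hW0 : W0 ≤ W)
    (hV : n * V ≤ W + B) (hB : γ * B ≤ n ^ 2 * (B0 + D)) (hDle : δ * D ≤ 8 * (W + R))
    (hB0le : G * B0 ≤ 2 * S0 + 4 * W0) (hWS : g * W ≤ S)
    (hE : R / 2 + S / 4 ≤ n * E) : γ * δ * G * g * V ≤ 104 * n ^ 2 * E := by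
  have hn0 : 0 < n := by linarith
  have t1 : γ * δ * G * (g * W) ≤ 2 * S := by
    have h1 : γ * δ ≤ 1 := mul_le_one₀ hγ1 hδ0 hδ1
    have h2 : γ * δ * G ≤ 2 := by nlinarith [mul_nonneg hγ0 hδ0]
    exact mul_le_mul h2 hWS (mul_nonneg hg0 hW) zero_le_two
  -- g(2S + 4W) ≤ 4S + 4S, from g ≤ 2 and gW ≤ S.
  have t2 : δ * g * (G * B0) ≤ 8 * S := by
    have h1 : g * (G * B0) ≤ 8 * S := by
      have := mul_le_mul_of_nonneg_left (hB0le.trans (by linarith : _ ≤ 2 * S + 4 * W)) hg0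
      nlinarith
    have h2 : 0 ≤ g * (G * B0) := mul_nonneg hg0 (mul_nonneg hG0 hB0)
    nlinarith
  have t3 : G * g * (δ * D) ≤ 16 * S + 32 * R := by
    have h1 : g * (δ * D) ≤ 8 * S + 16 * R := by
      have := mul_le_mul_of_nonneg_left hDle hg0
      nlinarith
    have h2 : 0 ≤ g * (δ * D) := mul_nonneg hg0 (mul_nonneg hδ0 hD)
    nlinarith
  have hc : 0 ≤ δ * G * g := mul_nonneg (mul_nonneg hδ0 hG0) hg0
  have t4 : γ * δ * G * g * (n * V) ≤ 2 * S + n ^ 2 * (24 * S + 32 * R) := by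
    have h1 := mul_le_mul_of_nonneg_left hV (mul_nonneg hγ0 hc)
    have h2 := mul_le_mul_of_nonneg_left hB hc
    have h3 : n ^ 2 * (δ * g * (G * B0) + G * g * (δ * D)) ≤ n ^ 2 * (24 * S + 32 * R) :=
      mul_le_mul_of_nonneg_left (by linarith) (sq_nonneg n)
    calc γ * δ * G * g * (n * V) = γ * (δ * G * g) * (n * V) := by ring
      _ ≤ γ * (δ * G * g) * (W + B) := h1
      _ = γ * δ * G * (g * W) + δ * G * g * (γ * B) := by ring
      _ ≤ 2 * S + δ * G * g * (n ^ 2 * (B0 + D)) := add_le_add t1 h2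
      _ = 2 * S + n ^ 2 * (δ * g * (G * B0) + G * g * (δ * D)) := by ring
      _ ≤ _ := by linarith
  have hn2 : 1 ≤ n ^ 2 := one_le_pow₀ hn
  -- n² ≥ 1 absorbs the first term, leaving 26S + 32R ≤ 104(R/2 + S/4); the coefficient of S
  -- determines 104 = 4 · 26.
  have t5 : 2 * S + n ^ 2 * (24 * S + 32 * R) ≤ n ^ 2 * (104 * (n * E)) := by
    have h1 : 2 * S ≤ n ^ 2 * (2 * S) := le_mul_of_one_le_left (by linarith) hn2
    have h2 : n ^ 2 * (2 * S + (24 * S + 32 * R)) ≤ n ^ 2 * (104 * (n * E)) :=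
      mul_le_mul_of_nonneg_left (by linarith) (sq_nonneg n)
    linarith
  refine le_of_mul_le_mul_left ?_ hn0
  calc n * (γ * δ * G * g * V) = γ * δ * G * g * (n * V) := by ring
    _ ≤ n ^ 2 * (104 * (n * E)) := t4.trans t5
    _ = n * (104 * n ^ 2 * E) := by ring

/-- A Poincaré inequality for simulated tempering. -/
lemma poincare_stKernel (hN : 1 ≤ N) (hp : ∀ k, Measurable (p k))
    (hp_one : ∀ k, ∫⁻ z, (p k z : ℝ≥0∞) ∂lam = 1)
    {T : Fin (N + 1) → Kernel X X} [∀ k, IsMarkovKernel (T k)]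
    (hT : ∀ k, (T k).IsReversible (densityMeasure lam (p k)))
    (hA : ∀ j, MeasurableSet (A j)) (hd : Pairwise fun i j => Disjoint (A i) (A j))
    (hc : ⋃ j, A j = Set.univ) (h0 : ∀ k j, densityMeasure lam (p k) (A j) ≠ 0) (j₀ : Fin J)
    {g : ℝ} (hg0 : 0 ≤ g) (hg2 : g ≤ 2)
    (hg : ∀ k j, g ≤ gap (restrictKernel (T k) (A j) (hA j))
      (restrictMeasure (densityMeasure lam (p k)) (A j)))
    {f : X × Fin (N + 1) → ℝ} (hfm : Measurable f) (hf : MemLp f 2 (stMeasure lam p)) :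
    gammaA lam p A * overlap lam p A *
        gap (projKernel (T 0) (densityMeasure lam (p 0)) A)
          (projMeasure (densityMeasure lam (p 0)) A) * g * variance f (stMeasure lam p) ≤
      104 * ((N : ℝ) + 1) ^ 2 * dirichletForm (stKernel p hp T) (stMeasure lam p) f := by
  have hprob : ∀ k, IsProbabilityMeasure (densityMeasure lam (p k)) := fun k =>
    isProbabilityMeasure_densityMeasure (hp_one k)
  have := isProbabilityMeasure_stMeasure hp_one
  have hpos : ∀ k j, 0 < (densityMeasure lam (p k)).real (A j) := fun k j =>
    ENNReal.toReal_pos (h0 k j) (measure_ne_top _ _)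
  have hfk := fun k => memLp_level hf k
  have hfkm : ∀ k, Measurable fun z => f (z, k) := fun k => hfm.comp measurable_prodMk_right
  have hQ := isReversible_levelUpdate (lam := lam) hp
  set q : Fin (N + 1) → Fin J → ℝ := fun k j => (densityMeasure lam (p k)).real (A j) with hq
  set a : Fin (N + 1) → Fin J → ℝ :=
    fun k j => ⨍ y in A j, f (y, k) ∂(densityMeasure lam (p k)) with ha
  set V : Fin (N + 1) → Fin J → ℝ :=
    fun k j => ∫ z in A j, (f (z, k) - a k j) ^ 2 ∂(densityMeasure lam (p k)) with hV
  -- the conditional mean of `f` given the state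
  set m : X → ℝ := fun z => ∑ l, ((p l z / ∑ i, p i z : ℝ≥0) : ℝ) * f (z, l) with hm
  -- For almost every z under π_k the density π_k(z) is nonzero, so the level update really
  -- resamples and its mean is the same function m at every level.
  have hmQ : ∀ k, (fun z => ∫ y, f y ∂(levelUpdate p hp (z, k)))
      =ᵐ[densityMeasure lam (p k)] m := by
    intro k
    filter_upwards [ae_ne_zero_densityMeasure (hp k)] with z hz
    refine integral_levelUpdate_of_ne hp hfm (fun h => hz ?_) k
    simpa using (Finset.sum_eq_zero_iff.1 h) k (Finset.mem_univ k)
  have hmL : ∀ k, MemLp m 2 (densityMeasure lam (p k)) := fun k =>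
    (memLp_level (memLp_integral_kernel hQ.invariant hf) k).ae_eq (hmQ k)
  set R : Fin (N + 1) → Fin J → ℝ :=
    fun k j => ∫ z in A j, (f (z, k) - m z) ^ 2 ∂(densityMeasure lam (p k)) with hR
  have hV0 : ∀ k j, 0 ≤ V k j := fun k j => integral_nonneg fun _ => sq_nonneg _
  have hR0 : ∀ k j, 0 ≤ R k j := fun k j => integral_nonneg fun _ => sq_nonneg _
  -- The mean of the cell averages under the projected distribution, so that B₀ is a variance for
  -- the projected chain.
  set c : ℝ := ∑ j, q 0 j * a 0 j with hcdef
  have hE0 : ∀ k, 0 ≤ dirichletForm (T k) (densityMeasure lam (p k)) fun z => f (z, k) :=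
    fun k => dirichletForm_nonneg (hT k).invariant (hfk k)
  have hmk := isMarkovKernel_projKernel (P := T 0) hA hd hc (h0 0)
  have hpp := isProbabilityMeasure_projMeasure (μ := densityMeasure lam (p 0)) hA hd hc
  have hpi := (isReversible_projKernel (hT 0) hA (h0 0)).invariant
  have hqd : ∀ j, ∑ i : Fin N, q i.castSucc j * (a i.castSucc j - a i.succ j) ^ 2 ≥ 0 :=
    fun j => Finset.sum_nonneg fun i _ => mul_nonneg (hpos _ j).le (sq_nonneg _)
  refine combine_estimates (n := (N : ℝ) + 1) (W := ∑ k, ∑ j, V k j)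
    (B := ∑ j, ∑ k, q k j * (a k j - c) ^ 2) (B0 := ∑ j, q 0 j * (a 0 j - c) ^ 2)
    (D := ∑ j, ∑ i : Fin N, q i.castSucc j * (a i.castSucc j - a i.succ j) ^ 2)
    (R := ∑ k, ∑ j, R k j)
    (S := ∑ k, dirichletForm (T k) (densityMeasure lam (p k)) fun z => f (z, k))
    (S0 := dirichletForm (T 0) (densityMeasure lam (p 0)) fun z => f (z, 0))
    (W0 := ∑ j, V 0 j) (by linarith [Nat.cast_nonneg (α := ℝ) N])
    (Finset.sum_nonneg fun k _ => Finset.sum_nonneg fun j _ => hV0 k j)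
    (Finset.sum_nonneg fun j _ => mul_nonneg (hpos 0 j).le (sq_nonneg _))
    (Finset.sum_nonneg fun j _ => hqd j)
    (Finset.sum_nonneg fun k _ => Finset.sum_nonneg fun j _ => hR0 k j)
    (Finset.sum_nonneg fun k _ => hE0 k)
    gammaA_nonneg (gammaA_le_one j₀) overlap_nonneg (overlap_le_one hN hp hp_one hA hpos j₀)
    (gap_nonneg hpi) (gap_le_two hpi) hg0 hg2
    (Finset.single_le_sum (fun k _ => hE0 k) (Finset.mem_univ 0))
    (Finset.single_le_sum (f := fun k => ∑ j, V k j)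
      (fun k _ => Finset.sum_nonneg fun j _ => hV0 k j) (Finset.mem_univ 0))
    (variance_stMeasure_le hp_one hA hd hc h0 hf c) ?_ ?_
    (gap_projKernel_mul_sum_le (hT 0) hA hd hc (h0 0) (hfk 0) (a 0)) ?_ ?_
  · rw [← Finset.sum_add_distrib, Finset.mul_sum, Finset.mul_sum]
    refine Finset.sum_le_sum fun j _ => ?_
    exact mul_sum_sq_sub_le (q := fun k => q k j) (fun k => (hpos k j).le)
      (fun i k hik => mul_le_of_le_prod_min (fun k => hpos k j) (gammaA_le j) hik)
      gammaA_nonneg (fun k => a k j) c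
  -- The 8 is the 4 of the overlap comparison times the 2 for each level being shared by two steps.
  · have hj : ∀ j, overlap lam p A *
        ∑ i : Fin N, q i.castSucc j * (a i.castSucc j - a i.succ j) ^ 2 ≤
          8 * ∑ k, (V k j + R k j) := by
      intro j
      have hi : ∀ i : Fin N, overlap lam p A * (q i.castSucc j * (a i.castSucc j - a i.succ j) ^ 2)
          ≤ 4 * ((V i.castSucc j + R i.castSucc j) + (V i.succ j + R i.succ j)) := by
        intro i
        have h1 := overlap_mul_sq_sub_le (A j) (hfk i.castSucc) (hfk i.succ) (hmL i.castSucc)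
          (hmL i.succ) (a i.castSucc j) (a i.succ j)
        have h2 := mul_le_mul_of_nonneg_right (overlap_mul_le hp hA hpos i j)
          (sq_nonneg (a i.castSucc j - a i.succ j))
        rw [← mul_assoc]
        refine (h2.trans h1).trans_eq ?_
        simp only [hV, hR]
        ring
      rw [Finset.mul_sum]
      refine (Finset.sum_le_sum fun i _ => hi i).trans ?_
      rw [← Finset.mul_sum]
      have := sum_castSucc_add_succ_le (x := fun k => V k j + R k j)
        fun k => add_nonneg (hV0 k j) (hR0 k j)
      linarith
    rw [Finset.mul_sum]
    refine (Finset.sum_le_sum fun j _ => hj j).trans_eq ?_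
    rw [← Finset.mul_sum, Finset.sum_comm]
    simp only [Finset.sum_add_distrib]
  · rw [Finset.mul_sum]
    exact Finset.sum_le_sum fun k _ =>
      mul_sum_setIntegral_le (hT k) hA hd hc (h0 k) (hfkm k) (hfk k) (hg k)
  -- The sandwich bound, multiplied by N + 1 to clear the level weights; the residual of the
  -- projection splits into the R k j.
  · have hTr := isReversible_stateUpdate hT
    have h := le_dirichletForm_sandwich hQ hTr.invariant (isReversible_lazy hTr).invariant
      (integral_levelUpdate_idem hp hfm) hfm hf
    have hL : MemLp (fun x => f x - ∫ y, f y ∂(levelUpdate p hp x)) 2 (stMeasure lam p) :=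
      hf.sub (memLp_integral_kernel hQ.invariant hf)
    rw [dirichletForm_stateUpdate hp_one hT hfm hf, integral_stMeasure hL.integrable_sq] at h
    have hRk : ∀ k, ∫ z, (f (z, k) - ∫ y, f y ∂(levelUpdate p hp (z, k))) ^ 2
        ∂(densityMeasure lam (p k)) = ∑ j, R k j := by
      intro k
      refine Eq.trans ?_ (integral_partition hA hd hc ((hfk k).sub (hmL k)).integrable_sq)
      refine integral_congr_ae ?_
      filter_upwards [hmQ k] with z hz
      simp only [hz]
    simp only [hRk] at h
    have hn : (0 : ℝ) < (N : ℝ) + 1 := by positivity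
    have h' := mul_le_mul_of_nonneg_left h hn.le
    refine le_trans (le_of_eq ?_) h'
    field_simp

end Main

end Tempering

/-! ### From the Poincaré inequality to the stated constant -/

theorem corollary3p1 {X : Type*} [MeasurableSpace X] (lam : Measure X) {N J : ℕ} (hN : 1 ≤ N)
    -- the densities `π_0, …, π_N`
    (p : Fin (N + 1) → X → ℝ≥0) (hp : ∀ k, Measurable (p k))
    (hp_one : ∀ k, ∫⁻ z, (p k z : ℝ≥0∞) ∂lam = 1)
    -- the `π_k`-reversible transition kernels `T_k`
    (T : Fin (N + 1) → Kernel X X) [∀ k, IsMarkovKernel (T k)]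
    (hT : ∀ k, (T k).IsReversible (Tempering.densityMeasure lam (p k)))
    -- the partition `A_1, …, A_J`
    (A : Fin J → Set X) (hA : ∀ j, MeasurableSet (A j))
    (hA_disj : Pairwise fun i j => Disjoint (A i) (A j)) (hA_cover : ⋃ j, A j = Set.univ)
    (hA_pos : ∀ k j, 0 < Tempering.densityMeasure lam (p k) (A j)) :
    Tempering.gammaA lam p A ^ (J + 3) * Tempering.overlap lam p A ^ 3 /
          (2 ^ 14 * ((N : ℝ) + 1) ^ 5 * (J : ℝ) ^ 3) *
        Tempering.gap (Tempering.projKernel (T 0) (Tempering.densityMeasure lam (p 0)) A)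
          (Tempering.projMeasure (Tempering.densityMeasure lam (p 0)) A) *
        (⨅ kj : Fin (N + 1) × Fin J,
          Tempering.gap (Tempering.restrictKernel (T kj.1) (A kj.2) (hA kj.2))
            (Tempering.restrictMeasure (Tempering.densityMeasure lam (p kj.1)) (A kj.2))) ≤
      Tempering.gap (Tempering.stKernel p hp T) (Tempering.stMeasure lam p) := by
  open Tempering in
  have hprob : ∀ k, IsProbabilityMeasure (densityMeasure lam (p k)) := fun k =>
    isProbabilityMeasure_densityMeasure (hp_one k)
  have hst := isProbabilityMeasure_stMeasure hp_one
  have h0 : ∀ k j, densityMeasure lam (p k) (A j) ≠ 0 := fun k j => (hA_pos k j).ne'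
  have hpos : ∀ k j, 0 < (densityMeasure lam (p k)).real (A j) := fun k j =>
    ENNReal.toReal_pos (h0 k j) (measure_ne_top _ _)
  -- An empty partition would make X empty, contradicting that π₀ has mass 1.
  have hJ : 1 ≤ J := by
    by_contra hJ
    obtain rfl : J = 0 := by omega
    have h1 := (hprob 0).measure_univ
    simp [← hA_cover] at h1
  let j₀ : Fin J := ⟨0, hJ⟩
  have hrp : ∀ k j, IsProbabilityMeasure (restrictMeasure (densityMeasure lam (p k)) (A j)) :=
    fun k j => isProbabilityMeasure_restrictMeasure (hA j) (h0 k j)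
  set g : ℝ := ⨅ kj : Fin (N + 1) × Fin J, gap (restrictKernel (T kj.1) (A kj.2) (hA kj.2))
    (restrictMeasure (densityMeasure lam (p kj.1)) (A kj.2)) with hgdef
  have hg : ∀ k j, g ≤ gap (restrictKernel (T k) (A j) (hA j))
      (restrictMeasure (densityMeasure lam (p k)) (A j)) := fun k j =>
    ciInf_le (Set.finite_range _).bddBelow ((k, j) : Fin (N + 1) × Fin J)
  have hg0 : 0 ≤ g := Real.iInf_nonneg fun kj =>
    gap_nonneg (isReversible_restrictKernel (hT kj.1) (hA kj.2)).invariant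
  have hg2 : g ≤ 2 := (hg 0 j₀).trans
    (gap_le_two (isReversible_restrictKernel (hT 0) (hA j₀)).invariant)
  have hmk := isMarkovKernel_projKernel (P := T 0) hA hA_disj hA_cover (h0 0)
  have hpp := isProbabilityMeasure_projMeasure (μ := densityMeasure lam (p 0)) hA hA_disj hA_cover
  have hpi := (isReversible_projKernel (hT 0) hA (h0 0)).invariant
  set G : ℝ := gap (projKernel (T 0) (densityMeasure lam (p 0)) A)
    (projMeasure (densityMeasure lam (p 0)) A) with hGdef
  have hG0 : 0 ≤ G := gap_nonneg hpi
  have hG2 : G ≤ 2 := gap_le_two hpi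
  set γ := gammaA lam p A
  set δ := overlap lam p A
  have hγ0 : 0 ≤ γ := gammaA_nonneg
  have hγ1 : γ ≤ 1 := gammaA_le_one j₀
  have hδ0 : 0 ≤ δ := overlap_nonneg
  have hδ1 : δ ≤ 1 := overlap_le_one hN hp hp_one hA hpos j₀
  have hn : (1 : ℝ) ≤ (N : ℝ) + 1 := by linarith [Nat.cast_nonneg (α := ℝ) N]
  have hJ' : (1 : ℝ) ≤ (J : ℝ) := by exact_mod_cast hJ
  have hQl := (isReversible_lazy (isReversible_levelUpdate (lam := lam) hp)).invariant
  have hTl := (isReversible_lazy (isReversible_stateUpdate hT)).invariant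
  have hinv : (stKernel p hp T).Invariant (stMeasure lam p) := (hQl.comp hTl).comp hQl
  have : IsMarkovKernel (stKernel p hp T) := by unfold stKernel; infer_instance
  -- All the slack is spent here: powers of γ, δ ≤ 1 only decrease, the powers of N + 1 and J only
  -- enlarge the denominator, and 104 ≤ 2¹⁴.
  have hcoef : γ ^ (J + 3) * δ ^ 3 / (2 ^ 14 * ((N : ℝ) + 1) ^ 5 * (J : ℝ) ^ 3) ≤
      γ * δ / (104 * ((N : ℝ) + 1) ^ 2) := by
    have h1 : γ ^ (J + 3) ≤ γ := pow_le_of_le_one hγ0 hγ1 (by omega)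
    have h2 : δ ^ 3 ≤ δ := pow_le_of_le_one hδ0 hδ1 (by norm_num)
    have h3 : ((N : ℝ) + 1) ^ 2 ≤ ((N : ℝ) + 1) ^ 5 := pow_le_pow_right₀ hn (by norm_num)
    have h4 : 1 ≤ (J : ℝ) ^ 3 := one_le_pow₀ hJ'
    have h5 : 104 * ((N : ℝ) + 1) ^ 2 ≤ 2 ^ 14 * ((N : ℝ) + 1) ^ 5 * (J : ℝ) ^ 3 := by
      refine le_trans ?_ (le_mul_of_one_le_right (by positivity) h4)
      exact mul_le_mul (by norm_num) h3 (by positivity) (by positivity)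
    exact div_le_div₀ (mul_nonneg hγ0 hδ0) (mul_le_mul h1 h2 (pow_nonneg hδ0 3) hγ0)
      (by positivity) h5
  have hn2 : 1 ≤ ((N : ℝ) + 1) ^ 2 := one_le_pow₀ hn
  have hmul : γ ^ (J + 3) * δ ^ 3 / (2 ^ 14 * ((N : ℝ) + 1) ^ 5 * (J : ℝ) ^ 3) * G * g ≤
      γ * δ / (104 * ((N : ℝ) + 1) ^ 2) * G * g :=
    mul_le_mul_of_nonneg_right (mul_le_mul_of_nonneg_right hcoef hG0) hg0
  refine hmul.trans (le_gap hinv ?_ fun f hfm hf => ?_)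
  -- The constant is at most 4/104 because both gaps are at most 2; `le_gap` requires it to be at
  -- most 1.
  · have h1 : γ * δ / (104 * ((N : ℝ) + 1) ^ 2) ≤ 1 / 104 := by
      refine div_le_div₀ zero_le_one (mul_le_one₀ hγ1 hδ0 hδ1) (by norm_num) ?_
      linarith
    have h2 : G * g ≤ 2 * 2 := mul_le_mul hG2 hg2 hg0 zero_le_two
    have h3 := mul_le_mul h1 h2 (mul_nonneg hG0 hg0) (by norm_num)
    rw [mul_assoc]
    linarith
  · have h := poincare_stKernel hN hp hp_one hT hA hA_disj hA_cover h0 j₀ hg0 hg2 hg hfm hf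
    change γ * δ * G * g * _ ≤ _ at h
    have hpos104 : (0 : ℝ) < 104 * ((N : ℝ) + 1) ^ 2 := by positivity
    refine le_of_mul_le_mul_left (le_trans (le_of_eq ?_) h) hpos104
    field_simp
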